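/- Conventions. A collection $B$ of nonempty subsets of $[n+1]=\{1,\dots,n+1\}$ is a *building set* on $[n+1]$ if $\{i\}\in B$ for all $i$, and $S,T\in B$, $S\cap T\neq\emptyset$ imply $S\cup T\in B$; it is *connected* if $[n+1]\in B$. Its nestohedron is the Minkowski sum $P_B=\sum_{S\in B}\operatorname{conv}\{e_i: i\in S\}\subset\mathbb{R}^{n+1}$. For connected $B$ and $S\in B\setminus\{[n+1]\}$, let $F_S=\{x\in P_B:\sum_{i\in S}x_i=|B|_S|\}$, where $B|_S=\{T\in B: T\subseteq S\}$, be the facet of $P_B$ corresponding to $S$. A polytope is *simple* if each of its vertices lies in exactly $\dim P$ facets. Two polytopes are *combinatorially equivalent*, $P\sim Q$, if their face lattices are isomorphic. A polytope $Q$ is obtained from a simple polytope $P$ by *shaving* a nonempty proper face $G$ of $P$ if there are a linear function $l$ and real numbers $c$ and $\varepsilon>0$ such that $l\le c$ on $P$, $\{x\in P: l(x)=c\}=G$, every vertex $v\notin G$ of $P$ satisfies $l(v)<c-\varepsilon$, and $Q=\{x\in P: l(x)\le c-\varepsilon\}$. Let $B_0\subseteq B_1$ be connected building sets on $[n+1]$.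 For $S\in B_1$, the *decomposition* $B_0(S)$ of $S$ by elements of $B_0$ is the representation of $S$ as a disjoint union of elements of $B_0$ with the minimal number of parts. Number the elements $S^1,\dots,S^N$ of $B_1\setminus B_0$ (each listed once) in any way such that $i\le j$ whenever $S^i\supseteq S^j$. Starting with $P_0=P_{B_0}$, for $i=1,\dots,N$ let $P_i$ be obtained from $P_{i-1}$ by shaving the face $$G^i=\bigcap_{T\in B_0(S^i)}\bigl(P_{i-1}\cap F_T\bigr),$$ where $P_{i-1}\cap F_T$ is what remains in $P_{i-1}$ of the facet $F_T$ of $P_{B_0}$. **Statement.** This procedure is well defined: for every $i\in\{1,\dots,N\}$ and all choices made in the preceding steps, $P_{i-1}$ is a simple polytope, $G^i$ is a nonempty proper face of it, and $P_{i-1}$ can be shaved along $G^i$. Every resulting polytope $P_{\mathrm{cut}}=P_N$ satisfies $P_{\mathrm{cut}}\sim P_{B_1}$. -/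

import Mathlib

open scoped Pointwise

/-- A building set on `[n+1]`, modelled as `Fin (n + 1)`. -/
structure IsBuildingSet {n : ℕ} (B : Finset (Finset (Fin (n + 1)))) : Prop where
  nonempty_of_mem : ∀ S ∈ B, S.Nonempty
  singleton_mem : ∀ i : Fin (n + 1), {i} ∈ B
  union_mem : ∀ S ∈ B, ∀ T ∈ B, (S ∩ T).Nonempty → S ∪ T ∈ B

/-- A connected building set: the whole ground set is an element. -/
structure IsConnectedBuildingSet {n : ℕ} (B : Finset (Finset (Fin (n + 1)))) : Prop
    extends IsBuildingSet B where
  univ_mem : Finset.univ ∈ B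

/-- The simplex `Δ^S = conv {e_i : i ∈ S}` in `ℝ^(n+1)`. -/
def coordSimplex {n : ℕ} (S : Finset (Fin (n + 1))) : Set (Fin (n + 1) → ℝ) :=
  convexHull ℝ ((fun i => (Pi.single i 1 : Fin (n + 1) → ℝ)) '' (S : Set (Fin (n + 1))))

/-- The nestohedron `P_B`, the Minkowski sum of the simplices `Δ^S` over `S ∈ B`. -/
def nestohedron {n : ℕ} (B : Finset (Finset (Fin (n + 1)))) : Set (Fin (n + 1) → ℝ) :=
  ∑ S ∈ B, coordSimplex S

/-- The restriction of `B` to `S`: the elements of `B` contained in `S`. -/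
def restrictTo {n : ℕ} (B : Finset (Finset (Fin (n + 1)))) (S : Finset (Fin (n + 1))) :
    Finset (Finset (Fin (n + 1))) :=
  B.filter (fun T => T ⊆ S)

/-- The facet `F_S` of `P_B` corresponding to `S`: the part of `P_B` on which the inequality
`∑_{i ∈ S} x_i ≥ |B|_S|`, valid on `P_B`, is an equality. -/
def nestoFacet {n : ℕ} (B : Finset (Finset (Fin (n + 1)))) (S : Finset (Fin (n + 1))) :
    Set (Fin (n + 1) → ℝ) :=
  {x ∈ nestohedron B | ∑ i ∈ S, x i = ((restrictTo B S).card : ℝ)}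

/-- `D` is a representation of `S` as a disjoint union of elements of `B`. -/
structure IsDisjointRep {n : ℕ} (B : Finset (Finset (Fin (n + 1)))) (S : Finset (Fin (n + 1)))
    (D : Finset (Finset (Fin (n + 1)))) : Prop where
  subset : D ⊆ B
  disjoint : ∀ T ∈ D, ∀ U ∈ D, T ≠ U → Disjoint T U
  union_eq : D.sup id = S

/-- `D` is the decomposition `B(S)` of `S` by elements of `B`: a disjoint representation with the
minimal number of parts. -/
def IsDecomposition {n : ℕ} (B : Finset (Finset (Fin (n + 1)))) (S : Finset (Fin (n + 1)))
    (D : Finset (Finset (Fin (n + 1)))) : Prop :=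
  IsDisjointRep B S D ∧ ∀ D', IsDisjointRep B S D' → D.card ≤ D'.card

section Polytopes

variable {E : Type*} [AddCommGroup E] [Module ℝ E] [TopologicalSpace E]

/-- A convex polytope: the convex hull of a finite set of points. -/
def IsPolytope (P : Set E) : Prop :=
  ∃ s : Set E, s.Finite ∧ P = convexHull ℝ s

/-- The dimension of (the affine hull of) a subset of a real vector space. -/
noncomputable def polyDim (P : Set E) : ℕ :=
  Module.finrank ℝ (vectorSpan ℝ P)

/-- `F` is a facet of the polytope `P`: a nonempty face of dimension `dim P - 1`. -/
def IsFacet (P F : Set E) : Prop :=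
  IsExposed ℝ P F ∧ F.Nonempty ∧ polyDim F + 1 = polyDim P

/-- A simple polytope: every vertex is contained in exactly `dim P` facets. -/
def IsSimplePolytope (P : Set E) : Prop :=
  IsPolytope P ∧ ∀ v ∈ P.extremePoints ℝ, {F : Set E | IsFacet P F ∧ v ∈ F}.ncard = polyDim P

/-- Combinatorial equivalence: the face lattices (including the empty face and the polytope itself)
are isomorphic. -/
def CombEquiv (P Q : Set E) : Prop :=
  Nonempty ({F : Set E // IsExposed ℝ P F} ≃o {F : Set E // IsExposed ℝ Q F})

/-- `Q` is obtained from the simple polytope `P` by shaving its nonempty proper face `G`: for some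
linear function `l` whose maximum `c` on `P` is attained exactly on `G`, and some `ε > 0` so small
that all vertices of `P` outside `G` lie strictly inside the half-space `l ≤ c - ε`, `Q` is the
part of `P` in that half-space. -/
def IsShaving (P G Q : Set E) : Prop :=
  IsSimplePolytope P ∧ G.Nonempty ∧ G ≠ P ∧
    ∃ (l : E →ₗ[ℝ] ℝ) (c ε : ℝ),
      (∀ x ∈ P, l x ≤ c) ∧ {x ∈ P | l x = c} = G ∧ 0 < ε ∧
      (∀ v ∈ P.extremePoints ℝ, v ∉ G → l v < c - ε) ∧
      Q = {x ∈ P | l x ≤ c - ε}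

end Polytopes

/-- One step of the cutting procedure, for a polytope `P` obtained from `P_{B₀}` by earlier
shavings: shave the face which is the intersection of the facets of `P` corresponding to the
elements of the decomposition `B₀(S)`. The facet of `P` corresponding to `T ∈ B₀` is what the
earlier shavings have left of the facet `F_T` of `P_{B₀}`, namely `P ∩ F_T`. -/
def IsCutStep {n : ℕ} (B₀ : Finset (Finset (Fin (n + 1)))) (S : Finset (Fin (n + 1)))
    (P Q : Set (Fin (n + 1) → ℝ)) : Prop :=
  ∃ D, IsDecomposition B₀ S D ∧ IsShaving P (⋂ T ∈ D, P ∩ nestoFacet B₀ T) Q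

/-- A numbering `S^1, …, S^N` (indexed from zero here) of the elements of `B₁ \ B₀`, each listed
once, such that `i ≤ j` whenever `S^i ⊇ S^j`. -/
structure IsReverseInclusionNumbering {n : ℕ} (B₀ B₁ : Finset (Finset (Fin (n + 1)))) {N : ℕ}
    (S : Fin N → Finset (Fin (n + 1))) : Prop where
  injective : Function.Injective S
  mem_iff : ∀ T, T ∈ B₁ \ B₀ ↔ ∃ i, S i = T
  le_of_superset : ∀ i j, S j ⊆ S i → i ≤ j

/-- `P 0, …, P k` is the sequence of polytopes of the cutting procedure up to step `k`: it starts
with `P_{B₀}`, and `P (i + 1)` results from `P i` by shaving the face given by `S i`, `i < k`. -/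
def IsCutSequence {n : ℕ} (B₀ : Finset (Finset (Fin (n + 1)))) {N : ℕ}
    (S : Fin N → Finset (Fin (n + 1))) (k : ℕ) (P : ℕ → Set (Fin (n + 1) → ℝ)) : Prop :=
  P 0 = nestohedron B₀ ∧ ∀ i : Fin N, (i : ℕ) < k → IsCutStep B₀ (S i) (P i) (P (i + 1))

/-! Each polytope is described by one root equation and finitely many inequalities whose active
functionals are independent at every point (`IsSimplePresentation`). Such a polytope is simple, and
its face lattice is determined by the family of active sets of its points (`combEquiv`).

For the nestohedron of a connected building set these active sets are exactly the nested sets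
(`IsConnectedBuildingSet.mem_activeSets_iff`). Shaving the face indexed by `D` adds one inequality
and performs a stellar subdivision: sets containing `D` disappear, and the new index is joined to
every `σ` that does not contain `D` but has `σ ∪ D` inside an old active set
(`mem_activeSets_shave_iff`). Inserting `S` into a building set, with decomposition `D` of `S`,
changes the nested sets by the same rule (`isNestedSet_insert_iff`).

Since larger sets are added first, every intermediate collection is a building set, and no
previously added set lies inside `S k`; so the decomposition of `S k` over `B₀` is also the one over
the current stage. By induction the active sets after `k` steps are the nested sets of stage `k`,
whatever functionals and depths were chosen, and the last stage is `B₁`. -/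

/-! ### Simple polytopes given by inequalities, and their active sets -/

section Presentations

open Filter Topology

variable {ι E : Type*}

section Algebra

variable [AddCommGroup E] [Module ℝ E]

/-- The indices of the inequalities `b i ≤ a i x` that are equalities at `x`. -/
noncomputable def activeSet (I : Finset ι) (a : ι → E →ₗ[ℝ] ℝ) (b : ι → ℝ) (x : E) : Finset ι :=
  I.filter (fun i => a i x = b i)

/-- The part of `P` on which the inequalities indexed by `σ` are equalities. -/
def presentedFace (P : Set E) (I : Finset ι) (a : ι → E →ₗ[ℝ] ℝ) (b : ι → ℝ) (σ : Finset ι) :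
    Set E :=
  {x ∈ P | σ ⊆ activeSet I a b x}

variable {I : Finset ι} {a : ι → E →ₗ[ℝ] ℝ} {b : ι → ℝ}

theorem mem_activeSet {x : E} {i : ι} : i ∈ activeSet I a b x ↔ i ∈ I ∧ a i x = b i := by
  simp [activeSet]

theorem activeSet_subset (x : E) : activeSet I a b x ⊆ I := Finset.filter_subset _ _

/-- Slacks are nonnegative, so a positively weighted sum of two of them vanishes only when both do.
-/
theorem activeSet_convexCombination [DecidableEq ι] {x y : E} (hx : ∀ i ∈ I, b i ≤ a i x)
    (hy : ∀ i ∈ I, b i ≤ a i y) {s t : ℝ} (hs : 0 < s) (ht : 0 < t) (hst : s + t = 1) :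
    activeSet I a b (s • x + t • y) = activeSet I a b x ∩ activeSet I a b y := by
  ext i
  simp only [mem_activeSet, Finset.mem_inter, map_add, map_smul, smul_eq_mul]
  constructor
  · rintro ⟨hi, h⟩
    have h1 := hx i hi
    have h2 := hy i hi
    have e : s * (a i x - b i) + t * (a i y - b i) = 0 := by linear_combination h - b i * hst
    have h3 : 0 ≤ s * (a i x - b i) := mul_nonneg hs.le (by linarith)
    have h4 : 0 ≤ t * (a i y - b i) := mul_nonneg ht.le (by linarith)
    have h5 : s * (a i x - b i) = 0 := by linarith
    have h6 : t * (a i y - b i) = 0 := by linarith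
    have h7 := (mul_eq_zero.1 h5).resolve_left hs.ne'
    have h8 := (mul_eq_zero.1 h6).resolve_left ht.ne'
    exact ⟨⟨hi, by linarith⟩, hi, by linarith⟩
  · rintro ⟨⟨hi, h1⟩, -, h2⟩
    refine ⟨hi, ?_⟩
    rw [h1, h2]
    linear_combination b i * hst

/-- Encodes a cut `l ≤ d` as the lower bound `-d ≤ -l` with the fresh index `s`. -/
theorem activeSet_insert_update [DecidableEq ι] {s : ι} {l : E →ₗ[ℝ] ℝ} {d : ℝ} (hs : s ∉ I)
    (x : E) :
    activeSet (insert s I) (Function.update a s (-l)) (Function.update b s (-d)) x =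
      if l x = d then insert s (activeSet I a b x) else activeSet I a b x := by
  ext i
  by_cases hi : i = s
  · subst hi
    have : i ∉ activeSet I a b x := fun h => hs (activeSet_subset x h)
    split_ifs with hl <;> simp [mem_activeSet, hl, this]
  · split_ifs <;> simp [mem_activeSet, hi]

end Algebra

variable [NormedAddCommGroup E] [NormedSpace ℝ E]

/-- A presentation of a compact convex set by one equation, with index `r`, and finitely many
inequalities, such that at each point the active functionals are linearly independent, that is,
take arbitrary values. -/
structure IsSimplePresentation (P : Set E) (I : Finset ι) (r : ι) (a : ι → E →ₗ[ℝ] ℝ)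
    (b : ι → ℝ) : Prop where
  root_mem : r ∈ I
  mem_iff : ∀ x, x ∈ P ↔ a r x = b r ∧ ∀ i ∈ I, b i ≤ a i x
  isCompact : IsCompact P
  exists_apply_eq : ∀ x ∈ P, ∀ c : ι → ℝ, ∃ v, ∀ i ∈ activeSet I a b x, a i v = c i

namespace IsSimplePresentation

variable {P : Set E} {I : Finset ι} {r : ι} {a : ι → E →ₗ[ℝ] ℝ} {b : ι → ℝ}

theorem le_apply (h : IsSimplePresentation P I r a b) {x : E} (hx : x ∈ P) {i : ι} (hi : i ∈ I) :
    b i ≤ a i x := ((h.mem_iff x).1 hx).2 i hi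

theorem root_mem_activeSet (h : IsSimplePresentation P I r a b) {x : E} (hx : x ∈ P) :
    r ∈ activeSet I a b x :=
  mem_activeSet.2 ⟨h.root_mem, ((h.mem_iff x).1 hx).1⟩

theorem convex (h : IsSimplePresentation P I r a b) : Convex ℝ P := by
  intro x hx y hy s t hs ht hst
  rw [h.mem_iff] at *
  simp only [map_add, map_smul, smul_eq_mul]
  refine ⟨by rw [hx.1, hy.1]; linear_combination b r * hst, fun i hi => ?_⟩
  have h1 := mul_le_mul_of_nonneg_left (hx.2 i hi) hs
  have h2 := mul_le_mul_of_nonneg_left (hy.2 i hi) ht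
  calc b i = s * b i + t * b i := by linear_combination -b i * hst
    _ ≤ _ := add_le_add h1 h2

theorem activeSet_combination [DecidableEq ι] (h : IsSimplePresentation P I r a b) {x y : E}
    (hx : x ∈ P) (hy : y ∈ P) {s t : ℝ} (hs : 0 < s) (ht : 0 < t) (hst : s + t = 1) :
    activeSet I a b (s • x + t • y) = activeSet I a b x ∩ activeSet I a b y :=
  activeSet_convexCombination (fun _ hi => h.le_apply hx hi) (fun _ hi => h.le_apply hy hi)
    hs ht hst

/-- Moving a little from a point in a direction in which no active functional decreases. -/
theorem eventually_add_smul_mem (h : IsSimplePresentation P I r a b) {x v : E} (hx : x ∈ P)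
    (hr : a r v = 0) (hv : ∀ i ∈ activeSet I a b x, 0 ≤ a i v) :
    ∀ᶠ t in 𝓝[>] (0 : ℝ), x + t • v ∈ P ∧
      activeSet I a b (x + t • v) = (activeSet I a b x).filter (fun i => a i v = 0) := by
  have key : ∀ i ∈ I, ∀ᶠ t in 𝓝[>] (0 : ℝ), b i ≤ a i x + t * a i v ∧
      (a i x + t * a i v = b i ↔ a i x = b i ∧ a i v = 0) := by
    intro i hi
    by_cases hb : a i x = b i
    · filter_upwards [self_mem_nhdsWithin] with t ht
      have ht : 0 < t := ht
      have := hv i (mem_activeSet.2 ⟨hi, hb⟩)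
      refine ⟨by rw [hb]; nlinarith [mul_nonneg ht.le this], ?_⟩
      simp [hb, ht.ne']
    · have hlt : b i < a i x := lt_of_le_of_ne (h.le_apply hx hi) (Ne.symm hb)
      have hc : Tendsto (fun t : ℝ => a i x + t * a i v) (𝓝[>] 0) (𝓝 (a i x + 0 * a i v)) := by
        apply tendsto_nhdsWithin_of_tendsto_nhds
        exact (by fun_prop : Continuous fun t : ℝ => a i x + t * a i v).tendsto 0
      have := hc.eventually (lt_mem_nhds (by simpa using hlt))
      filter_upwards [this] with t ht
      exact ⟨ht.le, fun e => absurd e ht.ne', fun e => absurd e.1 hb⟩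
  filter_upwards [(eventually_all_finset I).2 key] with t ht
  refine ⟨(h.mem_iff _).2 ⟨?_, fun i hi => ?_⟩, ?_⟩
  · simp [hr, ((h.mem_iff x).1 hx).1]
  · simpa using (ht i hi).1
  · ext i
    simp only [mem_activeSet, Finset.mem_filter, map_add, map_smul, smul_eq_mul]
    constructor
    · rintro ⟨hi, e⟩
      exact ⟨⟨hi, ((ht i hi).2.1 e).1⟩, ((ht i hi).2.1 e).2⟩
    · rintro ⟨⟨hi, e⟩, e'⟩
      exact ⟨hi, (ht i hi).2.2 ⟨e, e'⟩⟩

/-- A point is relatively interior to the face defined by its own active set. -/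
theorem exists_add_smul_mem (h : IsSimplePresentation P I r a b) {x v : E} (hx : x ∈ P)
    (hv : ∀ i ∈ activeSet I a b x, a i v = 0) :
    ∃ t : ℝ, 0 < t ∧ x + t • v ∈ P ∧ activeSet I a b (x + t • v) = activeSet I a b x := by
  obtain ⟨t, ht, ht0⟩ := ((h.eventually_add_smul_mem hx (hv r (h.root_mem_activeSet hx))
    (fun i hi => (hv i hi).ge)).and self_mem_nhdsWithin).exists
  refine ⟨t, ht0, ht.1, ht.2.trans (Finset.filter_true_of_mem hv)⟩

/-- The active sets are closed under passing to subsets that contain the root. -/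
theorem exists_activeSet_eq (h : IsSimplePresentation P I r a b) {x : E} (hx : x ∈ P)
    {τ : Finset ι} (hr : r ∈ τ) (hτ : τ ⊆ activeSet I a b x) :
    ∃ y ∈ P, activeSet I a b y = τ := by
  classical
  -- Along this direction the equalities in `τ` persist and all other active ones become strict.
  obtain ⟨v, hv⟩ := h.exists_apply_eq x hx (fun i => if i ∈ τ then 0 else 1)
  obtain ⟨t, ht⟩ := (h.eventually_add_smul_mem (v := v) hx
    (by rw [hv r (hτ hr), if_pos hr])
    (fun i hi => by rw [hv i hi]; split_ifs <;> norm_num)).exists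
  refine ⟨_, ht.1, ht.2.trans ?_⟩
  ext i
  simp only [Finset.mem_filter]
  constructor
  · rintro ⟨hi, e⟩
    by_contra hn
    simp [hv i hi, hn] at e
  · intro hi
    exact ⟨hτ hi, by rw [hv i (hτ hi), if_pos hi]⟩

/-- Exposed faces are cut out by active sets. -/
theorem exists_eq_presentedFace (h : IsSimplePresentation P I r a b) {F : Set E}
    (hF : IsExposed ℝ P F) (hne : F.Nonempty) :
    ∃ x ∈ F, F = presentedFace P I a b (activeSet I a b x) := by
  classical
  obtain ⟨l, hl⟩ := hF hne
  have hFP := hF.subset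
  have hconv := hF.convex h.convex
  -- A point of `F` with fewest active inequalities serves as a relative interior point.
  obtain ⟨x, hxF, hmin⟩ : ∃ x ∈ F, ∀ y ∈ F,
      (activeSet I a b x).card ≤ (activeSet I a b y).card := by
    obtain ⟨x, hx, e⟩ := (WellFounded.has_min
      (measure fun x : E => (activeSet I a b x).card).wf F hne)
    exact ⟨x, hx, fun y hy => not_lt.1 (e y hy)⟩
  refine ⟨x, hxF, Set.Subset.antisymm (fun y hy => ⟨hFP hy, ?_⟩) ?_⟩
  · have e := h.activeSet_combination (hFP hxF) (hFP hy) (s := 1/2) (t := 1/2)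
      (by norm_num) (by norm_num) (by norm_num)
    have hm := hmin _ (hconv hxF hy (a := 1/2) (b := 1/2)
      (by norm_num) (by norm_num) (by norm_num))
    rw [e] at hm
    exact Finset.inter_eq_left.1 (Finset.eq_of_subset_of_card_le Finset.inter_subset_left hm)
  · rintro y ⟨hyP, hy⟩
    -- The segment from `y` to `x` continues inside `P` beyond `x`; as `l` is maximal at `x`, this
    -- forces `l x ≤ l y`.
    obtain ⟨t, ht, hm, -⟩ := h.exists_add_smul_mem (v := x - y) (hFP hxF) (fun i hi => by
      rw [map_sub, (mem_activeSet.1 hi).2, (mem_activeSet.1 (hy hi)).2, sub_self])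
    rw [hl] at hxF ⊢
    have h1 := hxF.2 _ hm
    simp only [map_add, map_smul, map_sub, smul_eq_mul] at h1
    have h2 : l x ≤ l y := by
      by_contra hc
      have := mul_pos ht (sub_pos.2 (not_le.1 hc))
      linarith
    exact ⟨hyP, fun z hz => (hxF.2 z hz).trans h2⟩

theorem presentedFace_subset {σ : Finset ι} : presentedFace P I a b σ ⊆ P := fun _ hx => hx.1

theorem mem_presentedFace_activeSet {x : E} (hx : x ∈ P) :
    x ∈ presentedFace P I a b (activeSet I a b x) := ⟨hx, subset_rfl⟩

/-- The functionals active at `v` are constant on the segment from `x` to `v`, so it extends inside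
`P` beyond `v`, which extremality forbids unless `x = v`. -/
theorem eq_of_mem_extremePoints (h : IsSimplePresentation P I r a b) {v x : E}
    (hv : v ∈ P.extremePoints ℝ) (hx : x ∈ P) (hs : activeSet I a b v ⊆ activeSet I a b x) :
    x = v := by
  obtain ⟨t, ht, hm, -⟩ := h.exists_add_smul_mem (v := v - x) hv.1 (fun i hi => by
    rw [map_sub, (mem_activeSet.1 hi).2, (mem_activeSet.1 (hs hi)).2, sub_self])
  refine (mem_extremePoints_iff_left.1 hv).2 x hx _ hm ?_
  have hs : (1 + t)⁻¹ * (1 + t) = 1 := inv_mul_cancel₀ (by positivity)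
  refine ⟨t * (1 + t)⁻¹, (1 + t)⁻¹, by positivity, by positivity, by linarith, ?_⟩
  calc (t * (1 + t)⁻¹) • x + (1 + t)⁻¹ • (v + t • (v - x)) = ((1 + t)⁻¹ * (1 + t)) • v := by
        module
    _ = v := by rw [hs, one_smul]

theorem finite_extremePoints (h : IsSimplePresentation P I r a b) :
    (P.extremePoints ℝ).Finite := by
  refine Set.Finite.of_finite_image (f := activeSet I a b)
    (I.powerset.finite_toSet.subset ?_) ?_
  · rintro _ ⟨x, -, rfl⟩
    simpa using activeSet_subset x
  · intro x hx y hy e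
    exact h.eq_of_mem_extremePoints hy hx.1 e.ge

theorem finite_extremePoints_of_isExposed (h : IsSimplePresentation P I r a b) {F : Set E}
    (hF : IsExposed ℝ P F) : (F.extremePoints ℝ).Finite :=
  h.finite_extremePoints.subset hF.isExtreme.extremePoints_subset_extremePoints

/-- Krein–Milman, where finiteness of the extreme points makes the closure superfluous. -/
theorem convexHull_extremePoints (h : IsSimplePresentation P I r a b) {F : Set E}
    (hF : IsExposed ℝ P F) : convexHull ℝ (F.extremePoints ℝ) = F := by
  have := closure_convexHull_extremePoints (hF.isCompact h.isCompact) (hF.convex h.convex)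
  rwa [((h.finite_extremePoints_of_isExposed hF).isClosed_convexHull ℝ).closure_eq] at this

theorem isPolytope (h : IsSimplePresentation P I r a b) : IsPolytope P :=
  ⟨_, h.finite_extremePoints, (h.convexHull_extremePoints (IsExposed.refl P)).symm⟩

variable [FiniteDimensional ℝ E]

/-- If the face is nonempty, `∑ i ∈ σ, a i` attains the sum of its termwise lower bounds there, and
equality of the sums forces equality in each term. -/
theorem isExposed_presentedFace (h : IsSimplePresentation P I r a b) (σ : Finset ι) :
    IsExposed ℝ P (presentedFace P I a b σ) := by
  rintro ⟨z, hzP, hz⟩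
  have hσI : σ ⊆ I := hz.trans (activeSet_subset z)
  refine ⟨LinearMap.toContinuousLinearMap (-∑ i ∈ σ, a i), ?_⟩
  ext x
  simp only [presentedFace, Set.mem_ofPred_eq, LinearMap.coe_toContinuousLinearMap',
    LinearMap.neg_apply, LinearMap.sum_apply, neg_le_neg_iff]
  refine and_congr_right fun hx => ⟨fun hσ y hy => ?_, fun hmin => ?_⟩
  · refine Finset.sum_le_sum fun i hi => ?_
    rw [(mem_activeSet.1 (hσ hi)).2]
    exact h.le_apply hy (hσI hi)
  · have h1 := hmin z hzP
    have h2 : ∑ i ∈ σ, a i z = ∑ i ∈ σ, b i :=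
      Finset.sum_congr rfl fun i hi => (mem_activeSet.1 (hz hi)).2
    have h3 : ∀ i ∈ σ, b i ≤ a i x := fun i hi => h.le_apply hx (hσI hi)
    have h4 := (Finset.sum_eq_sum_iff_of_le h3).1
      (le_antisymm (Finset.sum_le_sum h3) (h1.trans h2.le))
    exact fun i hi => mem_activeSet.2 ⟨hσI hi, (h4 i hi).symm⟩

/-- The direction space of the face is the common kernel of the active functionals; independence
makes their joint map surjective, and rank–nullity applies. The root counts among the active
indices. -/
theorem polyDim_presentedFace (h : IsSimplePresentation P I r a b) {x : E} (hx : x ∈ P) :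
    polyDim (presentedFace P I a b (activeSet I a b x)) + (activeSet I a b x).card =
      Module.finrank ℝ E := by
  set σ := activeSet I a b x with hσ
  let f : E →ₗ[ℝ] (σ → ℝ) := LinearMap.pi fun i => a i
  have hker : vectorSpan ℝ (presentedFace P I a b σ) = LinearMap.ker f := by
    apply le_antisymm
    · rw [vectorSpan_def, Submodule.span_le]
      rintro _ ⟨y, hy, z, hz, rfl⟩
      simp only [SetLike.mem_coe, LinearMap.mem_ker]
      ext i
      simp [f, (mem_activeSet.1 (hy.2 i.2)).2, (mem_activeSet.1 (hz.2 i.2)).2]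
    · intro v hv
      have hv' : ∀ i ∈ σ, a i v = 0 := fun i hi => congrFun (LinearMap.mem_ker.1 hv) ⟨i, hi⟩
      obtain ⟨t, ht, hm, e⟩ := h.exists_add_smul_mem hx hv'
      have := vsub_mem_vectorSpan ℝ (s := presentedFace P I a b σ)
        (p₁ := x + t • v) (p₂ := x) ⟨hm, e.ge⟩ ⟨hx, subset_rfl⟩
      rw [vsub_eq_sub, add_sub_cancel_left] at this
      exact (Submodule.smul_mem_iff _ ht.ne').1 this
  have hsurj : LinearMap.range f = ⊤ := by
    rw [LinearMap.range_eq_top]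
    intro c
    classical
    obtain ⟨v, hv⟩ := h.exists_apply_eq x hx (fun i => if hi : i ∈ σ then c ⟨i, hi⟩ else 0)
    refine ⟨v, ?_⟩
    ext i
    simp only [f, LinearMap.pi_apply]
    rw [hv i i.2, dif_pos i.2]
  have := f.finrank_range_add_finrank_ker
  rw [hsurj, finrank_top, Module.finrank_fintype_fun_eq_card, Fintype.card_coe] at this
  rw [polyDim, hker]
  omega

theorem polyDim_add_one (h : IsSimplePresentation P I r a b) (hne : P.Nonempty) :
    polyDim P + 1 = Module.finrank ℝ E := by
  obtain ⟨x, hx⟩ := hne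
  obtain ⟨y, hy, e⟩ := h.exists_activeSet_eq hx (Finset.mem_singleton_self r)
    (by simpa using h.root_mem_activeSet hx)
  have := h.polyDim_presentedFace hy
  rw [e, Finset.card_singleton] at this
  rwa [show presentedFace P I a b {r} = P from Set.Subset.antisymm presentedFace_subset
    fun z hz => ⟨hz, by simpa using h.root_mem_activeSet hz⟩] at this

theorem card_activeSet_of_mem_extremePoints (h : IsSimplePresentation P I r a b) {v : E}
    (hv : v ∈ P.extremePoints ℝ) : (activeSet I a b v).card = Module.finrank ℝ E := by
  have := h.polyDim_presentedFace hv.1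
  rw [show presentedFace P I a b (activeSet I a b v) = {v} from Set.Subset.antisymm
    (fun x hx => h.eq_of_mem_extremePoints hv hx.1 hx.2)
    (by simpa using mem_presentedFace_activeSet hv.1)] at this
  rwa [polyDim, vectorSpan_singleton, finrank_bot, zero_add] at this

/-- Facets through a vertex correspond to its active indices other than the root, and there are
`finrank ℝ E - 1 = polyDim P` of those. -/
theorem isSimplePolytope (h : IsSimplePresentation P I r a b) : IsSimplePolytope P := by
  classical
  refine ⟨h.isPolytope, fun v hv => ?_⟩
  have hcard := h.card_activeSet_of_mem_extremePoints hv
  have hdim := h.polyDim_add_one ⟨v, hv.1⟩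
  have hrv := h.root_mem_activeSet hv.1
  have hpair : ∀ i ∈ (activeSet I a b v).erase r, ∃ y ∈ P, activeSet I a b y = {r, i} := by
    intro i hi
    refine h.exists_activeSet_eq hv.1 (by simp) ?_
    intro j hj
    rcases Finset.mem_insert.1 hj with rfl | hj
    · exact hrv
    · rw [Finset.mem_singleton.1 hj]; exact Finset.mem_of_mem_erase hi
  have himg : {F : Set E | IsFacet P F ∧ v ∈ F} =
      (fun i => presentedFace P I a b {r, i}) '' ((activeSet I a b v).erase r : Finset ι) := by
    ext F
    constructor
    · rintro ⟨⟨hF, hne, hd⟩, hvF⟩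
      obtain ⟨x, hxF, e⟩ := h.exists_eq_presentedFace hF hne
      have hx := hF.subset hxF
      have hd' := h.polyDim_presentedFace hx
      rw [← e] at hd'
      have hrx := h.root_mem_activeSet hx
      have hc : ((activeSet I a b x).erase r).card = 1 := by
        rw [Finset.card_erase_of_mem hrx]; omega
      obtain ⟨i, hi⟩ := Finset.card_eq_one.1 hc
      have hxi : activeSet I a b x = {r, i} := by
        rw [← Finset.insert_erase hrx, hi]
      have hi' : i ∈ (activeSet I a b x).erase r := by simp [hi]
      refine ⟨i, ?_, by rw [e, hxi]⟩
      rw [e] at hvF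
      exact Finset.mem_coe.2 (Finset.mem_erase.2
        ⟨Finset.ne_of_mem_erase hi', hvF.2 (Finset.mem_of_mem_erase hi')⟩)
    · rintro ⟨i, hi, rfl⟩
      have hi := Finset.mem_coe.1 hi
      obtain ⟨y, hy, e⟩ := hpair i hi
      have hd' := h.polyDim_presentedFace hy
      rw [e, Finset.card_pair (Finset.ne_of_mem_erase hi).symm] at hd'
      refine ⟨⟨h.isExposed_presentedFace _, ⟨y, hy, e.ge⟩, ?_⟩, hv.1, ?_⟩
      · change polyDim (presentedFace P I a b {r, i}) + 1 = _
        omega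
      · intro j hj
        rcases Finset.mem_insert.1 hj with rfl | hj
        · exact hrv
        · rw [Finset.mem_singleton.1 hj]; exact Finset.mem_of_mem_erase hi
  rw [himg, Set.InjOn.ncard_image, Set.ncard_coe_finset, Finset.card_erase_of_mem hrv]
  · omega
  · intro i hi j hj e
    obtain ⟨y, hy, ey⟩ := hpair i hi
    have : y ∈ presentedFace P I a b {r, j} := by
      rw [← show presentedFace P I a b {r, i} = presentedFace P I a b {r, j} from e]
      exact ⟨hy, ey.ge⟩
    have hj' := this.2 (show j ∈ ({r, j} : Finset ι) by simp)
    rw [ey] at hj'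
    simp only [Finset.mem_insert, Finset.mem_singleton] at hj'
    exact (hj'.resolve_left (Finset.ne_of_mem_erase (Finset.mem_coe.1 hj))).symm

/-- Exposed faces correspond under an equality of families of active sets. -/
theorem transfer_isExposed {P' : Set E} {I' : Finset ι} {r' : ι} {a' : ι → E →ₗ[ℝ] ℝ}
    {b' : ι → ℝ} (h : IsSimplePresentation P I r a b) (h' : IsSimplePresentation P' I' r' a' b')
    (hK : activeSet I a b '' P = activeSet I' a' b' '' P') {F : Set E} (hF : IsExposed ℝ P F) :
    IsExposed ℝ P' {y ∈ P' | ∃ x ∈ F, activeSet I a b x = activeSet I' a' b' y} ∧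
      {z ∈ P | ∃ y ∈ {y ∈ P' | ∃ x ∈ F, activeSet I a b x = activeSet I' a' b' y},
        activeSet I' a' b' y = activeSet I a b z} = F := by
  rcases F.eq_empty_or_nonempty with rfl | hne
  · constructor
    · simp only [Set.mem_empty_iff_false, false_and, exists_false, and_false]
      exact isExposed_empty
    · ext; simp
  obtain ⟨x₀, -, e⟩ := h.exists_eq_presentedFace hF hne
  constructor
  · convert h'.isExposed_presentedFace (activeSet I a b x₀) using 1
    ext y
    refine and_congr_right fun hy => ⟨?_, fun hs => ?_⟩
    · rintro ⟨x, hx, exy⟩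
      rw [← exy]
      rw [e] at hx
      exact hx.2
    · obtain ⟨x, hx, exy⟩ : activeSet I' a' b' y ∈ activeSet I a b '' P := by
        rw [hK]; exact ⟨y, hy, rfl⟩
      refine ⟨x, ?_, exy⟩
      rw [e]
      exact ⟨hx, hs.trans exy.ge⟩
  · ext z
    constructor
    · rintro ⟨hz, y, ⟨-, x, hx, exy⟩, eyz⟩
      rw [e] at hx ⊢
      exact ⟨hz, hx.2.trans (exy.trans eyz).le⟩
    · intro hz
      have hzP := hF.subset hz
      obtain ⟨y, hy, eyz⟩ : activeSet I a b z ∈ activeSet I' a' b' '' P' := by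
        rw [← hK]; exact ⟨z, hzP, rfl⟩
      exact ⟨hzP, y, ⟨hy, z, hz, eyz.symm⟩, eyz⟩

/-- Polytopes whose presentations have the same active sets are combinatorially equivalent. -/
theorem combEquiv {P' : Set E} {I' : Finset ι} {r' : ι} {a' : ι → E →ₗ[ℝ] ℝ}
    {b' : ι → ℝ} (h : IsSimplePresentation P I r a b) (h' : IsSimplePresentation P' I' r' a' b')
    (hK : activeSet I a b '' P = activeSet I' a' b' '' P') : CombEquiv P P' := by
  let e : {F : Set E // IsExposed ℝ P F} ≃ {F : Set E // IsExposed ℝ P' F} :=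
    { toFun := fun F => ⟨_, (h.transfer_isExposed h' hK F.2).1⟩
      invFun := fun F => ⟨_, (h'.transfer_isExposed h hK.symm F.2).1⟩
      left_inv := fun F => Subtype.ext (h.transfer_isExposed h' hK F.2).2
      right_inv := fun F => Subtype.ext (h'.transfer_isExposed h hK.symm F.2).2 }
  refine ⟨e.toOrderIso ?_ ?_⟩
  · rintro F G hFG y ⟨hy, x, hx, exy⟩
    exact ⟨hy, x, hFG hx, exy⟩
  · rintro F G hFG y ⟨hy, x, hx, exy⟩
    exact ⟨hy, x, hFG hx, exy⟩

/-! ### Shaving a face as stellar subdivision of the active sets -/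

section Shaving

variable {D : Finset ι} {l : E →ₗ[ℝ] ℝ} {c ε : ℝ}

/-- The smallest face through `x` is the hull of its vertices; if all of them lay on the face of
`D`, so would `x`. A vertex off that face is below the cut. -/
theorem exists_lt_of_not_subset_activeSet (h : IsSimplePresentation P I r a b)
    (hlt : ∀ v ∈ P.extremePoints ℝ, v ∉ presentedFace P I a b D → l v < c - ε) {x : E}
    (hx : x ∈ P) (hxD : ¬ D ⊆ activeSet I a b x) :
    ∃ v ∈ P, activeSet I a b x ⊆ activeSet I a b v ∧ l v < c - ε := by
  have hexp := h.isExposed_presentedFace (activeSet I a b x)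
  by_contra! hc
  have hsub : convexHull ℝ ((presentedFace P I a b (activeSet I a b x)).extremePoints ℝ) ⊆
      presentedFace P I a b D := by
    refine convexHull_min (fun v hv => ?_) ((h.isExposed_presentedFace D).convex h.convex)
    by_contra hvD
    exact (hc v hv.1.1 hv.1.2).not_gt
      (hlt v (hexp.isExtreme.extremePoints_subset_extremePoints hv) hvD)
  rw [h.convexHull_extremePoints hexp] at hsub
  exact hxD (hsub (mem_presentedFace_activeSet hx)).2

/-- If the smallest face through `x` had no vertex on the face of `D`, all its vertices, and with
them `x`, would be strictly below the cut. -/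
theorem exists_mem_of_le (h : IsSimplePresentation P I r a b)
    (hlt : ∀ v ∈ P.extremePoints ℝ, v ∉ presentedFace P I a b D → l v < c - ε) {x : E}
    (hx : x ∈ P) (hxl : c - ε ≤ l x) :
    ∃ w ∈ P, activeSet I a b x ⊆ activeSet I a b w ∧ D ⊆ activeSet I a b w := by
  have hexp := h.isExposed_presentedFace (activeSet I a b x)
  by_contra! hc
  have hsub : convexHull ℝ ((presentedFace P I a b (activeSet I a b x)).extremePoints ℝ) ⊆
      {y | l y < c - ε} := by
    refine convexHull_min (fun v hv => ?_) (convex_halfSpace_lt l.isLinear _)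
    exact hlt v (hexp.isExtreme.extremePoints_subset_extremePoints hv)
      fun hvD => hc v hv.1.1 hv.1.2 hvD.2
  rw [h.convexHull_extremePoints hexp] at hsub
  exact (hsub (mem_presentedFace_activeSet hx)).not_ge hxl

/-- Every nonempty proper face can be shaved. -/
theorem exists_isShaving (h : IsSimplePresentation P I r a b)
    (hne : (presentedFace P I a b D).Nonempty) (hP : presentedFace P I a b D ≠ P) :
    ∃ Q, IsShaving P (presentedFace P I a b D) Q := by
  obtain ⟨l, hl⟩ := h.isExposed_presentedFace D hne
  obtain ⟨z, hz⟩ := hne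
  have hzl : ∀ y ∈ P, l y ≤ l z := by rw [hl] at hz; exact hz.2
  have hface : {x ∈ P | l x = l z} = presentedFace P I a b D := by
    rw [hl]
    ext x
    refine and_congr_right fun hx => ⟨fun e y hy => e ▸ hzl y hy, fun e => ?_⟩
    exact le_antisymm (hzl x hx) (e z hz.1)
  have hev : ∀ᶠ ε in 𝓝[>] (0 : ℝ), ∀ v ∈ P.extremePoints ℝ,
      v ∉ presentedFace P I a b D → l v < l z - ε := by
    rw [eventually_all_finite h.finite_extremePoints]
    intro v hv
    by_cases hvD : v ∈ presentedFace P I a b D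
    · exact Eventually.of_forall fun _ e => absurd hvD e
    · have hlt : l v < l z := lt_of_le_of_ne (hzl v hv.1) fun e => hvD (by
        rw [← hface]; exact ⟨hv.1, e⟩)
      have hc : Tendsto (fun t : ℝ => l z - t) (𝓝[>] 0) (𝓝 (l z - 0)) := by
        apply tendsto_nhdsWithin_of_tendsto_nhds
        exact (by fun_prop : Continuous fun t : ℝ => l z - t).tendsto 0
      filter_upwards [hc.eventually (lt_mem_nhds (show l v < _ by simpa using hlt))] with t ht _
      exact ht
  obtain ⟨ε, hε, hε0⟩ := (hev.and self_mem_nhdsWithin).exists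
  exact ⟨_, h.isSimplePolytope, ⟨z, hz⟩, hP, l, l z, ε, hzl, hface, hε0, hε, rfl⟩

variable [DecidableEq ι] {s : ι}

theorem shave (h : IsSimplePresentation P I r a b) (hs : s ∉ I)
    (hface : {x ∈ P | l x = c} = presentedFace P I a b D) (hε : 0 < ε)
    (hlt : ∀ v ∈ P.extremePoints ℝ, v ∉ presentedFace P I a b D → l v < c - ε) :
    IsSimplePresentation {x ∈ P | l x ≤ c - ε} (insert s I) r (Function.update a s (-l))
      (Function.update b s (-(c - ε))) := by
  have hrs : r ≠ s := fun e => hs (e ▸ h.root_mem)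
  refine ⟨Finset.mem_insert_of_mem h.root_mem, fun x => ?_, ?_, ?_⟩
  · rw [Set.mem_ofPred_eq, h.mem_iff, Function.update_of_ne hrs, Function.update_of_ne hrs,
      and_assoc]
    refine and_congr_right fun _ => ?_
    rw [Finset.forall_mem_insert, and_comm]
    refine and_congr (by simp only [Function.update_self, LinearMap.neg_apply, neg_le_neg_iff])
      (forall₂_congr fun i hi => ?_)
    have : i ≠ s := fun e => hs (e ▸ hi)
    rw [Function.update_of_ne this, Function.update_of_ne this]
  · exact h.isCompact.inter_right
      (isClosed_le (LinearMap.continuous_of_finiteDimensional l) continuous_const)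
  · rintro x ⟨hx, hxl⟩ d
    obtain ⟨v, hv⟩ := h.exists_apply_eq x hx d
    rw [activeSet_insert_update hs]
    have hne : ∀ i ∈ activeSet I a b x, i ≠ s := fun i hi e => hs (e ▸ activeSet_subset x hi)
    split_ifs with hl
    · have hxD : ¬ D ⊆ activeSet I a b x := fun hD => by
        have : x ∈ {x ∈ P | l x = c} := by rw [hface]; exact ⟨hx, hD⟩
        have := this.2
        linarith
      obtain ⟨y, -, hxy, hy⟩ := h.exists_lt_of_not_subset_activeSet hlt hx hxD
      have hne0 : l (y - x) ≠ 0 := by rw [map_sub]; linarith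
      -- The old active functionals vanish on `y - x` and `l` does not, so this term corrects the
      -- value at `s` alone.
      refine ⟨v + ((-d s - l v) / l (y - x)) • (y - x), fun i hi => ?_⟩
      rcases Finset.mem_insert.1 hi with rfl | hi
      · simp only [Function.update_self, LinearMap.neg_apply]
        rw [map_add l, map_smul l, smul_eq_mul, div_mul_cancel₀ _ hne0]
        ring
      · rw [Function.update_of_ne (hne i hi), map_add, map_smul, hv i hi,
          map_sub (a i), (mem_activeSet.1 hi).2, (mem_activeSet.1 (hxy hi)).2]
        simp
    · exact ⟨v, fun i hi => by rw [Function.update_of_ne (hne i hi), hv i hi]⟩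

/-- The active sets of a shaved polytope form the stellar subdivision of the old ones. -/
theorem mem_activeSets_shave_iff (h : IsSimplePresentation P I r a b) (hs : s ∉ I)
    (hface : {x ∈ P | l x = c} = presentedFace P I a b D) (hε : 0 < ε)
    (hlt : ∀ v ∈ P.extremePoints ℝ, v ∉ presentedFace P I a b D → l v < c - ε) (τ : Finset ι) :
    τ ∈ activeSet (insert s I) (Function.update a s (-l)) (Function.update b s (-(c - ε))) ''
        {x ∈ P | l x ≤ c - ε} ↔
      (τ ∈ activeSet I a b '' P ∧ ¬ D ⊆ τ) ∨
      ∃ σ ∈ activeSet I a b '' P, ¬ D ⊆ σ ∧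
        (∃ ρ ∈ activeSet I a b '' P, σ ∪ D ⊆ ρ) ∧ τ = insert s σ := by
  have hD : ∀ x ∈ P, (D ⊆ activeSet I a b x ↔ l x = c) := fun x hx => by
    have : x ∈ {x ∈ P | l x = c} ↔ x ∈ presentedFace P I a b D := by rw [hface]
    exact ⟨fun hD => (this.2 ⟨hx, hD⟩).2, fun e => (this.1 ⟨hx, e⟩).2⟩
  -- On the segment from a low point `v` towards `x`, points near `v` already have the active set of
  -- `x` and are still strictly below the cut.
  have hnear : ∀ x ∈ P, ¬ D ⊆ activeSet I a b x →
      ∃ y ∈ P, activeSet I a b y = activeSet I a b x ∧ l y < c - ε := by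
    intro x hx hxD
    obtain ⟨v, hv, hxv, hvl⟩ := h.exists_lt_of_not_subset_activeSet hlt hx hxD
    have hc : Tendsto (fun t : ℝ => (1 - t) * l v + t * l x) (𝓝[>] 0)
        (𝓝 ((1 - 0) * l v + 0 * l x)) := by
      apply tendsto_nhdsWithin_of_tendsto_nhds
      exact (by fun_prop : Continuous fun t : ℝ => (1 - t) * l v + t * l x).tendsto 0
    have h1 := hc.eventually (gt_mem_nhds (show _ < c - ε by simpa using hvl))
    have h2 : ∀ᶠ t in 𝓝[>] (0 : ℝ), t < 1 :=
      tendsto_nhdsWithin_of_tendsto_nhds tendsto_id |>.eventually (gt_mem_nhds one_pos)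
    obtain ⟨t, ⟨ht, ht1⟩, ht0⟩ := ((h1.and h2).and self_mem_nhdsWithin).exists
    have ht0 : 0 < t := ht0
    refine ⟨(1 - t) • v + t • x, h.convex hv hx (by linarith) ht0.le (by ring), ?_, by simpa⟩
    rw [h.activeSet_combination hv hx (by linarith) ht0 (by ring)]
    exact Finset.inter_eq_right.2 hxv
  constructor
  · rintro ⟨x, ⟨hx, hxl⟩, rfl⟩
    have hxD : ¬ D ⊆ activeSet I a b x := fun e => by
      have := (hD x hx).1 e
      linarith
    rw [activeSet_insert_update hs]
    split_ifs with hl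
    · obtain ⟨w, hw, hxw, hwD⟩ := h.exists_mem_of_le hlt hx hl.ge
      exact Or.inr ⟨_, ⟨x, hx, rfl⟩, hxD, ⟨_, ⟨w, hw, rfl⟩, Finset.union_subset hxw hwD⟩, rfl⟩
    · exact Or.inl ⟨⟨x, hx, rfl⟩, hxD⟩
  · rintro (⟨⟨x, hx, rfl⟩, hxD⟩ | ⟨_, ⟨x, hx, rfl⟩, hxD, ⟨_, ⟨w, hw, rfl⟩, hwD⟩, rfl⟩)
    · obtain ⟨y, hy, e, hyl⟩ := hnear x hx hxD
      refine ⟨y, ⟨hy, hyl.le⟩, ?_⟩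
      rw [activeSet_insert_update hs, if_neg hyl.ne, e]
    · obtain ⟨y, hy, e, hyl⟩ := hnear x hx hxD
      have hwl : l w = c := (hD w hw).1 (Finset.union_subset_right hwD)
      -- The parameter at which the segment from `y`, below the cut, to `w`, on the shaved face,
      -- crosses the cut.
      set t : ℝ := (c - ε - l y) / (c - l y) with htdef
      have hpos : 0 < c - l y := by linarith
      have ht0 : 0 < t := div_pos (by linarith) hpos
      have ht1 : t < 1 := (div_lt_one hpos).2 (by linarith)
      have ht : t * (c - l y) = c - ε - l y := div_mul_cancel₀ _ hpos.ne'
      have hz : (1 - t) • y + t • w ∈ P := h.convex hy hw (by linarith) ht0.le (by ring)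
      have hzl : l ((1 - t) • y + t • w) = c - ε := by
        simp only [map_add, map_smul, smul_eq_mul, hwl]
        linear_combination ht
      refine ⟨_, ⟨hz, hzl.le⟩, ?_⟩
      rw [activeSet_insert_update hs, if_pos hzl,
        h.activeSet_combination hy hw (by linarith) ht0 (by ring), e,
        Finset.inter_eq_left.2 (Finset.union_subset_left hwD)]

end Shaving

end IsSimplePresentation

end Presentations

/-! ### Nested sets and the insertion of one element into a building set -/

section NestedSets

variable {n : ℕ}

theorem mem_restrictTo {B : Finset (Finset (Fin (n + 1)))} {S T : Finset (Fin (n + 1))} :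
    T ∈ restrictTo B S ↔ T ∈ B ∧ T ⊆ S := by simp [restrictTo]

/-- Nested sets, with the ground set included: no union of members is a new element of `B`. -/
structure IsNestedSet (B N : Finset (Finset (Fin (n + 1)))) : Prop where
  subset : N ⊆ B
  univ_mem : Finset.univ ∈ N
  sup_mem : ∀ A ⊆ N, A.sup id ∈ B → A.sup id ∈ A

namespace IsNestedSet

variable {B N : Finset (Finset (Fin (n + 1)))}

theorem mono (hN : IsNestedSet B N) {M : Finset (Finset (Fin (n + 1)))} (hM : M ⊆ N)
    (hu : Finset.univ ∈ M) : IsNestedSet B M :=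
  ⟨hM.trans hN.subset, hu, fun A hA => hN.sup_mem A (hA.trans hM)⟩

theorem subset_or_subset (hN : IsNestedSet B N) (hB : IsBuildingSet B)
    {S T : Finset (Fin (n + 1))} (hS : S ∈ N) (hT : T ∈ N) (hST : (S ∩ T).Nonempty) :
    S ⊆ T ∨ T ⊆ S := by
  have h := hN.sup_mem {S, T} (by
    intro R hR
    rcases Finset.mem_insert.1 hR with rfl | hR
    · exact hS
    · exact Finset.mem_singleton.1 hR ▸ hT)
  simp only [Finset.sup_insert, Finset.sup_singleton, id, Finset.sup_eq_union,
    Finset.mem_insert, Finset.mem_singleton, Finset.union_eq_left, Finset.union_eq_right] at h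
  exact (h (hB.union_mem S (hN.subset hS) T (hN.subset hT) hST)).symm

end IsNestedSet

namespace IsBuildingSet

variable {B N : Finset (Finset (Fin (n + 1)))}

theorem union_sup_mem (hB : IsBuildingSet B) {T : Finset (Fin (n + 1))} (hT : T ∈ B)
    (A : Finset (Finset (Fin (n + 1)))) (hA : A ⊆ B) (hAT : ∀ R ∈ A, (T ∩ R).Nonempty) :
    T ∪ A.sup id ∈ B := by
  induction A using Finset.induction_on with
  | empty => simpa
  | insert R A _ ih =>
    have h1 := ih ((Finset.subset_insert _ _).trans hA)
      fun R hR => hAT R (Finset.mem_insert_of_mem hR)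
    obtain ⟨i, hi⟩ := hAT R (Finset.mem_insert_self _ _)
    rw [Finset.mem_inter] at hi
    have h2 := hB.union_mem _ h1 R (hA (Finset.mem_insert_self _ _))
      ⟨i, by simp [hi.1, hi.2]⟩
    rw [Finset.sup_insert]
    convert h2 using 1
    ext j
    simp only [Finset.mem_union, id, Finset.sup_eq_union]
    tauto

/-- The smallest member of a nested set that contains `T ∈ B`, together with an element of `T`
that lies in no smaller member. -/
theorem exists_smallest (hB : IsBuildingSet B) (hN : IsNestedSet B N)
    {T : Finset (Fin (n + 1))} (hT : T ∈ B) :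
    ∃ M ∈ N, T ⊆ M ∧ (∀ R ∈ N, T ⊆ R → M ⊆ R) ∧ ∃ i ∈ T, ∀ R ∈ N, i ∈ R → M ⊆ R := by
  have hTne := hB.nonempty_of_mem T hT
  obtain ⟨M, hM, hmin⟩ := (N.filter (T ⊆ ·)).exists_minimal
    ⟨Finset.univ, by simp [hN.univ_mem]⟩
  rw [Finset.mem_filter] at hM
  have hcmp : ∀ R ∈ N, (R ∩ M).Nonempty → R ⊆ M ∨ M ⊆ R := fun R hR h =>
    hN.subset_or_subset hB hR hM.1 h
  have hsmall : ∀ R ∈ N, T ⊆ R → M ⊆ R := by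
    intro R hR hTR
    obtain ⟨i, hi⟩ := hTne
    rcases hcmp R hR ⟨i, Finset.mem_inter.2 ⟨hTR hi, hM.2 hi⟩⟩ with h | h
    · exact hmin (Finset.mem_filter.2 ⟨hR, hTR⟩) h
    · exact h
  refine ⟨M, hM.1, hM.2, hsmall, ?_⟩
  -- Otherwise members not containing `M` cover `T`. The union of those meeting `T` is then in `B`,
  -- hence is one of them, yet it contains `T` and so `M`.
  by_contra! hc
  set A := N.filter (fun R => (T ∩ R).Nonempty ∧ ¬ M ⊆ R) with hA
  have hTA : T ⊆ A.sup id := by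
    intro i hi
    obtain ⟨R, hR, hiR, hMR⟩ := hc i hi
    exact Finset.mem_sup.2 ⟨R, Finset.mem_filter.2 ⟨hR, ⟨i, Finset.mem_inter.2 ⟨hi, hiR⟩⟩, hMR⟩,
      hiR⟩
  have h1 := hB.union_sup_mem hT A ((Finset.filter_subset _ _).trans hN.subset)
    fun R hR => (Finset.mem_filter.1 hR).2.1
  rw [Finset.union_eq_right.2 hTA] at h1
  have h2 := hN.sup_mem A (Finset.filter_subset _ _) h1
  exact (Finset.mem_filter.1 h2).2.2 (hsmall _ (Finset.mem_filter.1 h2).1 hTA)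

/-- Inserting one element into a building set subdivides the complex of nested sets. -/
theorem isNestedSet_insert_iff (hB : IsBuildingSet B) (hu : Finset.univ ∈ B)
    {S : Finset (Fin (n + 1))} (hS : S ∉ B) (hBS : IsBuildingSet (insert S B))
    {D : Finset (Finset (Fin (n + 1)))} (hD : IsDisjointRep B S D)
    (hmax : ∀ T ∈ B, T ⊆ S → ∃ M ∈ D, T ⊆ M) (τ : Finset (Finset (Fin (n + 1)))) :
    IsNestedSet (insert S B) τ ↔ (IsNestedSet B τ ∧ ¬ D ⊆ τ) ∨
      ∃ σ, IsNestedSet B σ ∧ ¬ D ⊆ σ ∧ (∃ ρ, IsNestedSet B ρ ∧ σ ∪ D ⊆ ρ) ∧ τ = insert S σ := by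
  have hDS : ∀ M ∈ D, M ⊆ S := fun M hM => by
    rw [← hD.union_eq]; exact Finset.le_sup (f := id) hM
  have huS : Finset.univ ≠ S := fun e => hS (e ▸ hu)
  have hSne := hBS.nonempty_of_mem S (Finset.mem_insert_self _ _)
  have old : ∀ σ, IsNestedSet B σ → ¬ D ⊆ σ → IsNestedSet (insert S B) σ := by
    intro σ hσ hDσ
    refine ⟨hσ.subset.trans (Finset.subset_insert _ _), hσ.univ_mem, fun A hA hAB => ?_⟩
    rcases Finset.mem_insert.1 hAB with e | hAB
    · refine absurd (fun M hM => hA ?_) hDσ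
      -- Each member of `A` lies in one block of `D`, so those inside `M` cover `M`; nestedness then
      -- puts every block in `σ`.
      have hM' : (A.filter (· ⊆ M)).sup id = M := by
        apply le_antisymm
        · exact Finset.sup_le fun R hR => (Finset.mem_filter.1 hR).2
        · intro i hi
          have hi' := hDS M hM hi
          rw [← e] at hi'
          obtain ⟨R, hR, hiR⟩ := Finset.mem_sup.1 hi'
          have hRS : R ⊆ S := by rw [← e]; exact Finset.le_sup (f := id) hR
          obtain ⟨M', hM', hRM'⟩ := hmax R (hσ.subset (hA hR)) hRS
          have : M' = M := by
            by_contra hne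
            exact Finset.disjoint_left.1 (hD.disjoint M' hM' M hM hne) (hRM' hiR) hi
          exact Finset.mem_sup.2 ⟨R, Finset.mem_filter.2 ⟨hR, this ▸ hRM'⟩, hiR⟩
      have := hσ.sup_mem (A.filter (· ⊆ M)) ((Finset.filter_subset _ _).trans hA)
        (by rw [hM']; exact hD.subset hM)
      rw [hM'] at this
      exact (Finset.mem_filter.1 this).1
    · exact hσ.sup_mem A hA hAB
  have new : ∀ σ, IsNestedSet (insert S B) σ → S ∉ σ → IsNestedSet B σ ∧ ¬ D ⊆ σ := by
    intro σ hσ hSσ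
    have hσB : σ ⊆ B := fun T hT => (Finset.mem_insert.1 (hσ.subset hT)).resolve_left
      fun e => hSσ (e ▸ hT)
    refine ⟨⟨hσB, hσ.univ_mem, fun A hA hAB => hσ.sup_mem A hA (Finset.mem_insert_of_mem hAB)⟩,
      fun hDσ => ?_⟩
    have := hσ.sup_mem D hDσ (by rw [hD.union_eq]; exact Finset.mem_insert_self _ _)
    rw [hD.union_eq] at this
    exact hS (hD.subset this)
  constructor
  · intro hτ
    by_cases hSτ : S ∈ τ
    · right
      have hσ := new (τ.erase S) (hτ.mono (Finset.erase_subset _ _)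
        (Finset.mem_erase.2 ⟨huS, hτ.univ_mem⟩)) (by simp)
      refine ⟨τ.erase S, hσ.1, hσ.2, ⟨τ.erase S ∪ D, ⟨Finset.union_subset hσ.1.subset hD.subset,
        Finset.mem_union_left _ hσ.1.univ_mem, fun A hA hAB => ?_⟩, subset_rfl⟩,
        (Finset.insert_erase hSτ).symm⟩
      by_cases hAσ : A ⊆ τ.erase S
      · exact hσ.1.sup_mem A hAσ hAB
      obtain ⟨M, hMA, hMσ⟩ := Finset.not_subset.1 hAσ
      have hMD : M ∈ D := (Finset.mem_union.1 (hA hMA)).resolve_left hMσ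
      have hMU : M ⊆ A.sup id := Finset.le_sup (f := id) hMA
      have hUS : (S ∩ A.sup id).Nonempty := by
        obtain ⟨i, hi⟩ := hB.nonempty_of_mem M (hD.subset hMD)
        exact ⟨i, Finset.mem_inter.2 ⟨hDS M hMD hi, hMU hi⟩⟩
      -- Trading the blocks of `D` outside `τ.erase S` for `S` itself gives a subfamily of `τ`, to
      -- which nestedness of `τ` applies.
      set A₁ := A.filter (· ∈ τ.erase S) with hA₁
      have hsup : (insert S A₁).sup id = S ∪ A.sup id := by
        rw [Finset.sup_insert]
        apply le_antisymm
        · exact sup_le_sup le_rfl (Finset.sup_mono (Finset.filter_subset _ _))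
        · refine sup_le le_sup_left (Finset.sup_le fun R hR => ?_)
          by_cases hRσ : R ∈ τ.erase S
          · exact le_sup_of_le_right
              (Finset.le_sup (f := id) (Finset.mem_filter.2 ⟨hR, hRσ⟩))
          · exact le_sup_of_le_left
              (hDS R ((Finset.mem_union.1 (hA hR)).resolve_left hRσ))
      have hW := hτ.sup_mem (insert S A₁) (Finset.insert_subset hSτ fun R hR =>
        Finset.mem_of_mem_erase (Finset.mem_filter.1 hR).2) (by
          rw [hsup]
          exact hBS.union_mem _ (Finset.mem_insert_self _ _) _ (Finset.mem_insert_of_mem hAB) hUS)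
      rw [hsup] at hW
      rcases Finset.mem_insert.1 hW with e | hW
      · obtain ⟨M', hM', hUM'⟩ := hmax _ hAB (Finset.union_eq_left.1 e)
        have : M = M' := by
          by_contra hne
          obtain ⟨i, hi⟩ := hB.nonempty_of_mem M (hD.subset hMD)
          exact Finset.disjoint_left.1 (hD.disjoint M hMD M' hM' hne) hi (hUM' (hMU hi))
        rwa [Finset.Subset.antisymm (this ▸ hUM') hMU]
      · have hWA := (Finset.mem_filter.1 hW).1
        have : S ∪ A.sup id ⊆ A.sup id := Finset.le_sup (f := id) hWA
        rwa [Finset.union_eq_right.2 (Finset.union_subset_left this)] at hWA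
    · exact Or.inl (new τ hτ hSτ)
  · rintro (⟨hτ, hDτ⟩ | ⟨σ, hσ, hDσ, ⟨ρ, hρ, hσρ⟩, rfl⟩)
    · exact old τ hτ hDτ
    · refine ⟨Finset.insert_subset_insert _ hσ.subset, Finset.mem_insert_of_mem hσ.univ_mem,
        fun A hA hAB => ?_⟩
      by_cases hSA : S ∈ A
      · rcases Finset.mem_insert.1 hAB with e | hAB
        · rwa [e]
        have hA' : A.erase S ⊆ σ := by
          rw [← Finset.subset_insert_iff]; exact hA
        -- The reverse trade, `S` for its blocks, allows the union to be tested in `ρ`.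
        have hsup : (A.erase S ∪ D).sup id = A.sup id := by
          rw [Finset.sup_union, hD.union_eq]
          conv_rhs => rw [← Finset.insert_erase hSA, Finset.sup_insert]
          exact sup_comm _ _
        have := hρ.sup_mem (A.erase S ∪ D)
          ((Finset.union_subset_union_left hA').trans hσρ) (by rwa [hsup])
        rw [hsup] at this
        rcases Finset.mem_union.1 this with h | h
        · exact Finset.mem_of_mem_erase h
        · have h1 : S ⊆ A.sup id := Finset.le_sup (f := id) hSA
          exact absurd (hD.subset h) (by rwa [← Finset.Subset.antisymm h1 (hDS _ h)])
      · exact (old σ hσ hDσ).sup_mem A ((Finset.subset_insert_iff_of_notMem hSA).1 hA) hAB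

end IsBuildingSet

/-! ### Decompositions into maximal elements -/

section Decomposition

variable {B : Finset (Finset (Fin (n + 1)))}

/-- The maximal elements of `B` contained in `S`. -/
def maximalIn (B : Finset (Finset (Fin (n + 1)))) (S : Finset (Fin (n + 1))) :
    Finset (Finset (Fin (n + 1))) :=
  (restrictTo B S).filter fun T => ∀ U ∈ restrictTo B S, T ⊆ U → T = U

theorem exists_mem_maximalIn {S T : Finset (Fin (n + 1))} (hT : T ∈ B) (hTS : T ⊆ S) :
    ∃ M ∈ maximalIn B S, T ⊆ M := by
  obtain ⟨M, hTM, hM, hmax⟩ := (restrictTo B S).exists_le_maximal (mem_restrictTo.2 ⟨hT, hTS⟩)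
  exact ⟨M, Finset.mem_filter.2 ⟨hM, fun U hU hMU => Finset.Subset.antisymm hMU (hmax hU hMU)⟩, hTM⟩

theorem IsBuildingSet.eq_of_mem_maximalIn (hB : IsBuildingSet B) {S T U : Finset (Fin (n + 1))}
    (hT : T ∈ maximalIn B S) (hU : U ∈ maximalIn B S) (h : (T ∩ U).Nonempty) : T = U := by
  rw [maximalIn, Finset.mem_filter] at hT hU
  have hT' := mem_restrictTo.1 hT.1
  have hU' := mem_restrictTo.1 hU.1
  have hTU : T ∪ U ∈ restrictTo B S :=
    mem_restrictTo.2 ⟨hB.union_mem T hT'.1 U hU'.1 h, Finset.union_subset hT'.2 hU'.2⟩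
  exact (hT.2 _ hTU Finset.subset_union_left).trans (hU.2 _ hTU Finset.subset_union_right).symm

theorem IsBuildingSet.isDisjointRep_maximalIn (hB : IsBuildingSet B) (S : Finset (Fin (n + 1))) :
    IsDisjointRep B S (maximalIn B S) := by
  refine ⟨fun T hT => (mem_restrictTo.1 (Finset.mem_filter.1 hT).1).1, fun T hT U hU hne => ?_, ?_⟩
  · rw [Finset.disjoint_iff_inter_eq_empty, ← Finset.not_nonempty_iff_eq_empty]
    exact fun h => hne (hB.eq_of_mem_maximalIn hT hU h)
  · apply le_antisymm
    · exact Finset.sup_le fun T hT => (mem_restrictTo.1 (Finset.mem_filter.1 hT).1).2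
    · intro i hi
      obtain ⟨M, hM, hiM⟩ := exists_mem_maximalIn (hB.singleton_mem i)
        (Finset.singleton_subset_iff.2 hi)
      exact Finset.mem_sup.2 ⟨M, hM, Finset.singleton_subset_iff.1 hiM⟩

/-- Each disjoint representation maps onto the maximal elements. -/
theorem IsBuildingSet.exists_surjOn_maximalIn (hB : IsBuildingSet B) {S : Finset (Fin (n + 1))}
    {D : Finset (Finset (Fin (n + 1)))} (hD : IsDisjointRep B S D) :
    ∃ f : Finset (Fin (n + 1)) → Finset (Fin (n + 1)),
      (∀ T ∈ D, T ⊆ f T) ∧ Set.MapsTo f D (maximalIn B S) ∧ Set.SurjOn f D (maximalIn B S) := by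
  have hex : ∀ T, ∃ M, T ∈ D → M ∈ maximalIn B S ∧ T ⊆ M := fun T => by
    by_cases hT : T ∈ D
    · obtain ⟨M, hM, hTM⟩ := exists_mem_maximalIn (S := S) (hD.subset hT)
        (by rw [← hD.union_eq]; exact Finset.le_sup (f := id) hT)
      exact ⟨M, fun _ => ⟨hM, hTM⟩⟩
    · exact ⟨∅, fun h => absurd h hT⟩
  choose f hf using hex
  refine ⟨f, fun T hT => (hf T hT).2, fun T hT => (hf T hT).1, fun M hM => ?_⟩
  have hM' := mem_restrictTo.1 (Finset.mem_filter.1 (Finset.mem_coe.1 hM)).1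
  obtain ⟨i, hi⟩ := hB.nonempty_of_mem M hM'.1
  have hiS := hM'.2 hi
  rw [← hD.union_eq] at hiS
  obtain ⟨T, hT, hiT⟩ := Finset.mem_sup.1 hiS
  exact ⟨T, hT, hB.eq_of_mem_maximalIn (hf T hT).1 hM
    ⟨i, Finset.mem_inter.2 ⟨(hf T hT).2 hiT, hi⟩⟩⟩

theorem IsBuildingSet.isDecomposition_maximalIn (hB : IsBuildingSet B)
    (S : Finset (Fin (n + 1))) : IsDecomposition B S (maximalIn B S) := by
  refine ⟨hB.isDisjointRep_maximalIn S, fun D hD => ?_⟩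
  obtain ⟨f, -, hm, hs⟩ := hB.exists_surjOn_maximalIn hD
  exact Finset.card_le_card_of_surjOn f hs

/-- With the least number of parts, the surjection sending a part to the maximal element above it is
injective, so each maximal element is filled by a single part. -/
theorem IsBuildingSet.eq_maximalIn_of_isDecomposition (hB : IsBuildingSet B)
    {S : Finset (Fin (n + 1))} {D : Finset (Finset (Fin (n + 1)))} (hD : IsDecomposition B S D) :
    D = maximalIn B S := by
  have hle := hD.2 _ (hB.isDisjointRep_maximalIn S)
  obtain ⟨f, hf, hm, hs⟩ := hB.exists_surjOn_maximalIn hD.1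
  have hinj := Finset.injOn_of_surjOn_of_card_le f hm hs hle
  refine (Finset.eq_of_subset_of_card_le (fun M hM => ?_) hle).symm
  obtain ⟨T, hT, rfl⟩ := hs hM
  have hMS := (mem_restrictTo.1 (Finset.mem_filter.1 hM).1).2
  have : f T ⊆ T := by
    intro i hi
    have hiS := hMS hi
    rw [← hD.1.union_eq] at hiS
    obtain ⟨U, hU, hiU⟩ := Finset.mem_sup.1 hiS
    have : f U = f T := hB.eq_of_mem_maximalIn (hm hU) hM
      ⟨i, Finset.mem_inter.2 ⟨hf U hU hiU, hi⟩⟩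
    exact hinj hU hT this ▸ hiU
  rwa [Finset.Subset.antisymm this (hf T hT)]

end Decomposition

end NestedSets

/-! ### Facet inequalities of the nestohedron and its active sets -/

section Nestohedra

variable {n : ℕ}

/-- The sum of the coordinates in `S`, as a linear functional. -/
noncomputable def coordSum (S : Finset (Fin (n + 1))) : (Fin (n + 1) → ℝ) →ₗ[ℝ] ℝ :=
  ∑ i ∈ S, LinearMap.proj i

theorem coordSum_apply (S : Finset (Fin (n + 1))) (x : Fin (n + 1) → ℝ) :
    coordSum S x = ∑ i ∈ S, x i := by simp [coordSum]

theorem coordSum_single (S : Finset (Fin (n + 1))) (i : Fin (n + 1)) :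
    coordSum S (Pi.single i (1 : ℝ)) = if i ∈ S then 1 else 0 := by
  simp [coordSum_apply, Pi.single_apply]

/-- The right-hand side of the inequality of the nestohedron indexed by `S`. -/
noncomputable def nestoBound (B : Finset (Finset (Fin (n + 1)))) (S : Finset (Fin (n + 1))) : ℝ :=
  (restrictTo B S).card

/-- The polyhedron given by the facet inequalities of the nestohedron. -/
def nestoPolyhedron (B : Finset (Finset (Fin (n + 1)))) : Set (Fin (n + 1) → ℝ) :=
  {x | coordSum Finset.univ x = nestoBound B Finset.univ ∧ ∀ S ∈ B, nestoBound B S ≤ coordSum S x}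

variable {B : Finset (Finset (Fin (n + 1)))}

/-- Coordinate sums add over the maximal elements of `B` inside `U`, and every element of `B` inside
`U` lies in one of these. Sets outside `B` are needed because intersections of tight sets occur in
`tight_sup`. -/
theorem IsBuildingSet.nestoBound_le (hB : IsBuildingSet B) {x : Fin (n + 1) → ℝ}
    (hx : ∀ S ∈ B, nestoBound B S ≤ coordSum S x) (U : Finset (Fin (n + 1))) :
    nestoBound B U ≤ coordSum U x := by
  have hrep := hB.isDisjointRep_maximalIn U
  have hU : (maximalIn B U).biUnion id = U := by
    rw [← Finset.sup_eq_biUnion]; exact hrep.union_eq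
  have h1 : (restrictTo B U).card ≤ ∑ M ∈ maximalIn B U, (restrictTo B M).card := by
    refine (Finset.card_le_card fun T hT => ?_).trans Finset.card_biUnion_le
    obtain ⟨hTB, hTU⟩ := mem_restrictTo.1 hT
    obtain ⟨M, hM, hTM⟩ := exists_mem_maximalIn hTB hTU
    exact Finset.mem_biUnion.2 ⟨M, hM, mem_restrictTo.2 ⟨hTB, hTM⟩⟩
  calc nestoBound B U ≤ ∑ M ∈ maximalIn B U, nestoBound B M := by
        unfold nestoBound; exact_mod_cast h1
    _ ≤ ∑ M ∈ maximalIn B U, coordSum M x := Finset.sum_le_sum fun M hM => hx M (hrep.subset hM)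
    _ = coordSum U x := by
        simp only [coordSum_apply]
        conv_rhs => rw [← hU]
        exact (Finset.sum_biUnion (t := id) fun S hS T hT hne => hrep.disjoint S hS T hT hne).symm

/-- Unions of tight sets are tight, and contain no new element of `B`. -/
theorem IsBuildingSet.tight_sup (hB : IsBuildingSet B) {x : Fin (n + 1) → ℝ}
    (hx : ∀ S ∈ B, nestoBound B S ≤ coordSum S x) (A : Finset (Finset (Fin (n + 1))))
    (hA : ∀ S ∈ A, coordSum S x = nestoBound B S) :
    coordSum (A.sup id) x = nestoBound B (A.sup id) ∧
      ∀ T ∈ B, T ⊆ A.sup id → ∃ S ∈ A, T ⊆ S := by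
  induction A using Finset.induction_on with
  | empty =>
    have hempty : ∀ T ∈ B, ¬ T ⊆ ∅ := fun T hT h =>
      (hB.nonempty_of_mem T hT).ne_empty (Finset.subset_empty.1 h)
    refine ⟨?_, fun T hT h => absurd h (hempty T hT)⟩
    have : restrictTo B ∅ = ∅ := Finset.filter_eq_empty_iff.2 fun T hT => hempty T hT
    simp [coordSum_apply, nestoBound, this]
  | insert S A _ ih =>
    obtain ⟨hU, hT⟩ := ih fun R hR => hA R (Finset.mem_insert_of_mem hR)
    have hS := hA S (Finset.mem_insert_self _ _)
    rw [Finset.sup_insert]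
    set U := A.sup id
    change coordSum (S ∪ U) x = nestoBound B (S ∪ U) ∧
      ∀ T ∈ B, T ⊆ S ∪ U → ∃ S' ∈ insert S A, T ⊆ S'
    -- Coordinate sums are modular and `nestoBound` is supermodular, so tightness of `S` and `U`
    -- forces equality: an element of `B` inside `S ∪ U` lies in `S` or in `U`.
    have hsum : coordSum (S ∪ U) x + coordSum (S ∩ U) x = coordSum S x + coordSum U x := by
      simp only [coordSum_apply, Finset.sum_union_inter]
    have h1 := hB.nestoBound_le hx (S ∪ U)
    have h2 := hB.nestoBound_le hx (S ∩ U)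
    have hinter : restrictTo B S ∩ restrictTo B U = restrictTo B (S ∩ U) := by
      ext T
      simp only [Finset.mem_inter, mem_restrictTo, Finset.subset_inter_iff]
      tauto
    have hunion : restrictTo B S ∪ restrictTo B U ⊆ restrictTo B (S ∪ U) := by
      intro T hT
      rcases Finset.mem_union.1 hT with h | h
      · exact mem_restrictTo.2 ⟨(mem_restrictTo.1 h).1,
          (mem_restrictTo.1 h).2.trans Finset.subset_union_left⟩
      · exact mem_restrictTo.2 ⟨(mem_restrictTo.1 h).1,
          (mem_restrictTo.1 h).2.trans Finset.subset_union_right⟩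
    have hcard := Finset.card_union_add_card_inter (restrictTo B S) (restrictTo B U)
    rw [hinter] at hcard
    have hcard' : ((restrictTo B S ∪ restrictTo B U).card : ℝ) + nestoBound B (S ∩ U) =
        nestoBound B S + nestoBound B U := by
      unfold nestoBound; exact_mod_cast hcard
    have hle : ((restrictTo B S ∪ restrictTo B U).card : ℝ) ≤ nestoBound B (S ∪ U) := by
      unfold nestoBound; exact_mod_cast Finset.card_le_card hunion
    have hle' : nestoBound B (S ∪ U) ≤ ((restrictTo B S ∪ restrictTo B U).card : ℝ) := by
      linarith
    refine ⟨by linarith, fun T hTB hTU => ?_⟩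
    have heq := Finset.eq_of_subset_of_card_le hunion (by
      unfold nestoBound at hle'; exact_mod_cast hle')
    have hmem := mem_restrictTo.2 ⟨hTB, hTU⟩
    rw [← heq] at hmem
    rcases Finset.mem_union.1 hmem with h | h
    · exact ⟨S, Finset.mem_insert_self _ _, (mem_restrictTo.1 h).2⟩
    · obtain ⟨R, hR, hTR⟩ := hT T hTB (mem_restrictTo.1 h).2
      exact ⟨R, Finset.mem_insert_of_mem hR, hTR⟩

theorem IsConnectedBuildingSet.isNestedSet_activeSet (hB : IsConnectedBuildingSet B)
    {x : Fin (n + 1) → ℝ} (hx : x ∈ nestoPolyhedron B) :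
    IsNestedSet B (activeSet B coordSum (nestoBound B) x) := by
  refine ⟨activeSet_subset x, mem_activeSet.2 ⟨hB.univ_mem, hx.1⟩, fun A hA hAB => ?_⟩
  obtain ⟨S, hS, hle⟩ := (hB.toIsBuildingSet.tight_sup hx.2 A
    fun S hS => (mem_activeSet.1 (hA hS)).2).2 _ hAB subset_rfl
  rwa [Finset.Subset.antisymm hle (Finset.le_sup (f := id) hS)]

/-- The system is triangular: a maximal `S` in `σ` has an element `i` that lies in no other set of
`σ`, and changing coordinate `i` adjusts the equation of `S` alone. -/
theorem IsNestedSet.exists_coordSum_eq {N : Finset (Finset (Fin (n + 1)))}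
    (hB : IsBuildingSet B) (hN : IsNestedSet B N) (c : Finset (Fin (n + 1)) → ℝ)
    (σ : Finset (Finset (Fin (n + 1)))) (hσ : σ ⊆ N) :
    ∃ v : Fin (n + 1) → ℝ, ∀ S ∈ σ, coordSum S v = c S := by
  induction σ using Finset.strongInduction with
  | H σ ih =>
    rcases σ.eq_empty_or_nonempty with rfl | hne
    · exact ⟨0, by simp⟩
    obtain ⟨S, hS, hmax⟩ := σ.exists_maximal hne
    obtain ⟨v, hv⟩ := ih (σ.erase S) (Finset.erase_ssubset hS)
      ((Finset.erase_subset _ _).trans hσ)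
    obtain ⟨M, -, hSM, -, i, hi, hcore⟩ := hB.exists_smallest hN (hN.subset (hσ hS))
    refine ⟨v + (c S - coordSum S v) • Pi.single i (1 : ℝ), fun T hT => ?_⟩
    rw [map_add, map_smul, coordSum_single, smul_eq_mul]
    by_cases hTS : T = S
    · subst hTS
      rw [if_pos hi]; ring
    · rw [if_neg fun hiT => hTS ?_, hv T (Finset.mem_erase.2 ⟨hTS, hT⟩), mul_zero, add_zero]
      have hST : S ⊆ T := hSM.trans (hcore T (hσ hT) hiT)
      exact Finset.Subset.antisymm (hmax hT hST) hST

theorem isCompact_nestoPolyhedron (hB : IsBuildingSet B) : IsCompact (nestoPolyhedron B) := by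
  have hclosed : IsClosed (nestoPolyhedron B) := by
    rw [show nestoPolyhedron B = {x | coordSum Finset.univ x = nestoBound B Finset.univ} ∩
      ⋂ S ∈ B, {x | nestoBound B S ≤ coordSum S x} by ext; simp [nestoPolyhedron]]
    refine IsClosed.inter (isClosed_eq (LinearMap.continuous_of_finiteDimensional _)
      continuous_const) ?_
    exact isClosed_biInter fun S _ => isClosed_le continuous_const
      (LinearMap.continuous_of_finiteDimensional _)
  refine (isCompact_Icc (a := (0 : Fin (n + 1) → ℝ))
    (b := fun _ => nestoBound B Finset.univ)).of_isClosed_subset hclosed fun x hx => ?_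
  have h0 : ∀ i, 0 ≤ x i := fun i => by
    have := hx.2 {i} (hB.singleton_mem i)
    rw [coordSum_apply, Finset.sum_singleton] at this
    exact (Nat.cast_nonneg _).trans this
  refine ⟨h0, fun i => ?_⟩
  rw [← hx.1, coordSum_apply]
  exact Finset.single_le_sum (fun j _ => h0 j) (Finset.mem_univ i)

theorem IsConnectedBuildingSet.isSimplePresentation_nestoPolyhedron
    (hB : IsConnectedBuildingSet B) :
    IsSimplePresentation (nestoPolyhedron B) B Finset.univ coordSum (nestoBound B) where
  root_mem := hB.univ_mem
  mem_iff _ := Iff.rfl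
  isCompact := isCompact_nestoPolyhedron hB.toIsBuildingSet
  exists_apply_eq _ hx c := (hB.isNestedSet_activeSet hx).exists_coordSum_eq hB.toIsBuildingSet c _
    subset_rfl

theorem sum_eq_one_of_mem_coordSimplex {T : Finset (Fin (n + 1))} {p : Fin (n + 1) → ℝ}
    (hp : p ∈ coordSimplex T) : (∀ i, 0 ≤ p i) ∧ ∑ i, p i = 1 ∧ ∀ i ∉ T, p i = 0 := by
  have hconv : Convex ℝ {p : Fin (n + 1) → ℝ |
      (∀ i, 0 ≤ p i) ∧ ∑ i, p i = 1 ∧ ∀ i ∉ T, p i = 0} := by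
    rintro p ⟨hp0, hp1, hpT⟩ q ⟨hq0, hq1, hqT⟩ s t hs ht hst
    refine ⟨fun i => ?_, ?_, fun i hi => ?_⟩
    · exact add_nonneg (mul_nonneg hs (hp0 i)) (mul_nonneg ht (hq0 i))
    · simp only [Pi.add_apply, Pi.smul_apply, smul_eq_mul, Finset.sum_add_distrib,
        ← Finset.mul_sum, hp1, hq1]
      linarith
    · simp [hpT i hi, hqT i hi]
  refine convexHull_min ?_ hconv hp
  rintro _ ⟨i, hi, rfl⟩
  refine ⟨fun j => ?_, by simp, fun j hj => ?_⟩
  · by_cases h : j = i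
    · subst h; simp
    · simp [h]
  · have : j ≠ i := fun e => hj (e ▸ hi)
    simp [this]

theorem coordSum_eq_one {S T : Finset (Fin (n + 1))} {p : Fin (n + 1) → ℝ}
    (hp : p ∈ coordSimplex T) (hTS : T ⊆ S) : coordSum S p = 1 := by
  obtain ⟨-, h1, h⟩ := sum_eq_one_of_mem_coordSimplex hp
  rw [coordSum_apply, ← h1]
  exact Finset.sum_subset (Finset.subset_univ _) fun i _ hi => h i fun hT => hi (hTS hT)

/-- Each summand with `T ⊆ S` contributes exactly `1`; the remaining sum is the slack of the
inequality. -/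
theorem coordSum_sum_of_mem_coordSimplex {p : Finset (Fin (n + 1)) → Fin (n + 1) → ℝ}
    (hp : ∀ T ∈ B, p T ∈ coordSimplex T) (S : Finset (Fin (n + 1))) :
    coordSum S (∑ T ∈ B, p T) =
      nestoBound B S + ∑ T ∈ B with ¬ T ⊆ S, coordSum S (p T) := by
  rw [map_sum, ← Finset.sum_filter_add_sum_filter_not B (· ⊆ S)]
  congr 1
  rw [Finset.sum_congr rfl fun T hT => coordSum_eq_one (hp T (Finset.mem_filter.1 hT).1)
    (Finset.mem_filter.1 hT).2]
  simp [nestoBound, restrictTo]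

theorem nestohedron_subset_nestoPolyhedron : nestohedron B ⊆ nestoPolyhedron B := by
  intro x hx
  obtain ⟨p, hp, rfl⟩ := (Set.mem_finsetSum B coordSimplex x).1 hx
  refine ⟨?_, fun S _ => ?_⟩
  · rw [coordSum_sum_of_mem_coordSimplex fun T hT => hp hT]
    simp
  · rw [coordSum_sum_of_mem_coordSimplex fun T hT => hp hT]
    refine le_add_of_nonneg_right (Finset.sum_nonneg fun T hT => ?_)
    rw [coordSum_apply]
    exact Finset.sum_nonneg fun i _ =>
      (sum_eq_one_of_mem_coordSimplex (hp (Finset.mem_filter.1 hT).1)).1 i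

/-- The elements of `T` that lie only in members of `N` containing `T`. -/
def nestedCore (N : Finset (Finset (Fin (n + 1)))) (T : Finset (Fin (n + 1))) :
    Finset (Fin (n + 1)) :=
  T.filter fun i => ∀ R ∈ N, i ∈ R → T ⊆ R

/-- The barycentre of the core of `T`. -/
noncomputable def coreBarycenter (N : Finset (Finset (Fin (n + 1)))) (T : Finset (Fin (n + 1))) :
    Fin (n + 1) → ℝ :=
  ∑ i ∈ nestedCore N T, ((nestedCore N T).card : ℝ)⁻¹ • Pi.single i 1

theorem coordSum_coreBarycenter (N : Finset (Finset (Fin (n + 1)))) (S T : Finset (Fin (n + 1))) :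
    coordSum S (coreBarycenter N T) =
      ((nestedCore N T ∩ S).card : ℝ) * ((nestedCore N T).card : ℝ)⁻¹ := by
  simp only [coreBarycenter, map_sum, map_smul, coordSum_single, smul_eq_mul, ← Finset.mul_sum,
    Finset.sum_ite_mem, Finset.sum_const, nsmul_eq_mul, mul_one]
  ring

theorem coreBarycenter_mem {N : Finset (Finset (Fin (n + 1)))} {T : Finset (Fin (n + 1))}
    (hne : (nestedCore N T).Nonempty) : coreBarycenter N T ∈ coordSimplex T := by
  refine (convex_convexHull ℝ _).sum_mem (fun i _ => by positivity) ?_ fun i hi => ?_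
  · rw [Finset.sum_const, nsmul_eq_mul, mul_inv_cancel₀]
    exact_mod_cast hne.card_pos.ne'
  · exact subset_convexHull ℝ _ ⟨i, (Finset.mem_filter.1 hi).1, rfl⟩

/-- Every nested set is the active set of a point of the nestohedron. -/
theorem IsNestedSet.exists_activeSet_eq {N : Finset (Finset (Fin (n + 1)))}
    (hB : IsBuildingSet B) (hN : IsNestedSet B N) :
    ∃ x ∈ nestohedron B, activeSet B coordSum (nestoBound B) x = N := by
  have hcore : ∀ T ∈ B, (nestedCore N T).Nonempty := fun T hT => by
    obtain ⟨M, -, hTM, -, i, hi, h⟩ := hB.exists_smallest hN hT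
    exact ⟨i, Finset.mem_filter.2 ⟨hi, fun R hR hiR => hTM.trans (h R hR hiR)⟩⟩
  have hmem : ∀ T ∈ B, coreBarycenter N T ∈ coordSimplex T := fun T hT =>
    coreBarycenter_mem (hcore T hT)
  -- For this point `S` is tight exactly when it misses the core of every `T ∈ B` not contained in
  -- `S`.
  refine ⟨∑ T ∈ B, coreBarycenter N T, Set.finsetSum_mem_finsetSum _ _ _ hmem, ?_⟩
  ext S
  rw [mem_activeSet, coordSum_sum_of_mem_coordSimplex hmem, add_eq_left,
    Finset.sum_eq_zero_iff_of_nonneg fun T _ => by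
      rw [coordSum_coreBarycenter]
      exact mul_nonneg (Nat.cast_nonneg _) (inv_nonneg.2 (Nat.cast_nonneg _))]
  constructor
  · rintro ⟨hS, h0⟩
    -- If `S ∉ N`, the smallest member `M` around `S` is strictly larger, and its core meets `S` in
    -- `i`.
    obtain ⟨M, hM, hSM, -, i, hi, h⟩ := hB.exists_smallest hN hS
    by_contra hSN
    have hMB := hN.subset hM
    have hMS : ¬ M ⊆ S := fun hMS => hSN (Finset.Subset.antisymm hSM hMS ▸ hM)
    have := h0 M (Finset.mem_filter.2 ⟨hMB, hMS⟩)
    rw [coordSum_coreBarycenter] at this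
    have h1 : 0 < (nestedCore N M).card := (hcore M hMB).card_pos
    have h2 : 0 < (nestedCore N M ∩ S).card := Finset.card_pos.2
      ⟨i, Finset.mem_inter.2 ⟨Finset.mem_filter.2 ⟨hSM hi, h⟩, hi⟩⟩
    exact (mul_pos (Nat.cast_pos.2 h2) (inv_pos.2 (Nat.cast_pos.2 h1))).ne' this
  · intro hS
    refine ⟨hN.subset hS, fun T hT => ?_⟩
    have hTS := (Finset.mem_filter.1 hT).2
    have : nestedCore N T ∩ S = ∅ := by
      rw [← Finset.not_nonempty_iff_eq_empty]
      rintro ⟨i, hi⟩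
      rw [Finset.mem_inter] at hi
      exact hTS ((Finset.mem_filter.1 hi.1).2 S hS hi.2)
    rw [coordSum_coreBarycenter, this]
    simp

/-- The active set of a vertex of the polyhedron is nested, hence realised in the nestohedron, and
only the vertex itself can realise it. -/
theorem IsConnectedBuildingSet.nestohedron_eq (hB : IsConnectedBuildingSet B) :
    nestohedron B = nestoPolyhedron B := by
  refine Set.Subset.antisymm nestohedron_subset_nestoPolyhedron ?_
  have h := hB.isSimplePresentation_nestoPolyhedron
  rw [← h.convexHull_extremePoints (IsExposed.refl _)]
  refine convexHull_min (fun v hv => ?_) (convex_sum _ fun S _ => convex_convexHull ℝ _)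
  obtain ⟨x, hx, e⟩ := (hB.isNestedSet_activeSet hv.1).exists_activeSet_eq hB.toIsBuildingSet
  rwa [← h.eq_of_mem_extremePoints hv (nestohedron_subset_nestoPolyhedron hx) e.ge]

theorem IsConnectedBuildingSet.isSimplePresentation (hB : IsConnectedBuildingSet B) :
    IsSimplePresentation (nestohedron B) B Finset.univ coordSum (nestoBound B) :=
  hB.nestohedron_eq ▸ hB.isSimplePresentation_nestoPolyhedron

theorem IsConnectedBuildingSet.mem_activeSets_iff (hB : IsConnectedBuildingSet B)
    (N : Finset (Finset (Fin (n + 1)))) :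
    N ∈ activeSet B coordSum (nestoBound B) '' nestohedron B ↔ IsNestedSet B N := by
  constructor
  · rintro ⟨x, hx, rfl⟩
    exact hB.isNestedSet_activeSet (nestohedron_subset_nestoPolyhedron hx)
  · exact fun hN => hN.exists_activeSet_eq hB.toIsBuildingSet

end Nestohedra

/-! ### The stages of the cutting procedure -/

section CuttingProcedure

variable {n : ℕ}

section Faces

variable {B D : Finset (Finset (Fin (n + 1)))} {S : Finset (Fin (n + 1))}

theorem IsDisjointRep.subset_of_mem (hD : IsDisjointRep B S D) {M : Finset (Fin (n + 1))}
    (hM : M ∈ D) : M ⊆ S := by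
  rw [← hD.union_eq]; exact Finset.le_sup (f := id) hM

/-- A union of blocks that belongs to `B` lies inside a single block. This will make the face to be
shaved nonempty. -/
theorem IsDisjointRep.isNestedSet_insert_univ (hB : IsConnectedBuildingSet B)
    (hD : IsDisjointRep B S D) (hmax : ∀ T ∈ B, T ⊆ S → ∃ M ∈ D, T ⊆ M) :
    IsNestedSet B (insert Finset.univ D) := by
  refine ⟨Finset.insert_subset hB.univ_mem hD.subset, Finset.mem_insert_self _ _,
    fun A hA hAB => ?_⟩
  by_cases hu : Finset.univ ∈ A
  · rwa [Finset.univ_subset_iff.1 (Finset.le_sup (f := id) hu)]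
  have hAD : A ⊆ D := (Finset.subset_insert_iff_of_notMem hu).1 hA
  obtain ⟨M, hM, hAM⟩ := hmax _ hAB (Finset.sup_le fun R hR => hD.subset_of_mem (hAD hR))
  obtain ⟨i, hi⟩ := hB.nonempty_of_mem _ hAB
  obtain ⟨R, hR, hiR⟩ := Finset.mem_sup.1 hi
  have hRA : R ⊆ A.sup id := Finset.le_sup (f := id) hR
  have : R = M := by
    by_contra hne
    exact Finset.disjoint_left.1 (hD.disjoint R (hAD hR) M hM hne) hiR (hAM hi)
  rwa [Finset.Subset.antisymm (this ▸ hAM) hRA]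

end Faces

/-- The building set reached after the first `k` steps of the procedure. -/
def stage (B₀ : Finset (Finset (Fin (n + 1)))) {N : ℕ} (S : Fin N → Finset (Fin (n + 1)))
    (k : ℕ) : Finset (Finset (Fin (n + 1))) :=
  B₀ ∪ (Finset.univ.filter fun i : Fin N => (i : ℕ) < k).image S

variable {B₀ B₁ : Finset (Finset (Fin (n + 1)))} {N : ℕ} {S : Fin N → Finset (Fin (n + 1))}

theorem mem_stage {k : ℕ} {T : Finset (Fin (n + 1))} :
    T ∈ stage B₀ S k ↔ T ∈ B₀ ∨ ∃ i : Fin N, (i : ℕ) < k ∧ S i = T := by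
  simp [stage]

theorem stage_succ (k : Fin N) : stage B₀ S (k + 1) = insert (S k) (stage B₀ S k) := by
  ext T
  simp only [Finset.mem_insert, mem_stage]
  constructor
  · rintro (h | ⟨i, hi, rfl⟩)
    · exact Or.inr (Or.inl h)
    · rcases Nat.lt_succ_iff_lt_or_eq.1 hi with h | h
      · exact Or.inr (Or.inr ⟨i, h, rfl⟩)
      · exact Or.inl (by rw [Fin.ext h])
  · rintro (rfl | h | ⟨i, hi, rfl⟩)
    · exact Or.inr ⟨k, Nat.lt_succ_self _, rfl⟩
    · exact Or.inl h
    · exact Or.inr ⟨i, Nat.lt_succ_of_lt hi, rfl⟩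

namespace IsReverseInclusionNumbering

theorem mem (hS : IsReverseInclusionNumbering B₀ B₁ S) (i : Fin N) : S i ∈ B₁ ∧ S i ∉ B₀ :=
  Finset.mem_sdiff.1 ((hS.mem_iff _).2 ⟨i, rfl⟩)

theorem stage_subset (hS : IsReverseInclusionNumbering B₀ B₁ S) (hsub : B₀ ⊆ B₁) (k : ℕ) :
    stage B₀ S k ⊆ B₁ := by
  intro T hT
  rcases mem_stage.1 hT with h | ⟨i, -, rfl⟩
  · exact hsub h
  · exact (hS.mem i).1

theorem stage_eq (hS : IsReverseInclusionNumbering B₀ B₁ S) (hsub : B₀ ⊆ B₁) :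
    stage B₀ S N = B₁ := by
  refine Finset.Subset.antisymm (hS.stage_subset hsub N) fun T hT => mem_stage.2 ?_
  by_cases h : T ∈ B₀
  · exact Or.inl h
  · obtain ⟨i, hi⟩ := (hS.mem_iff T).1 (Finset.mem_sdiff.2 ⟨hT, h⟩)
    exact Or.inr ⟨i, i.2, hi⟩

theorem notMem_stage (hS : IsReverseInclusionNumbering B₀ B₁ S) (k : Fin N) :
    S k ∉ stage B₀ S k := by
  intro h
  rcases mem_stage.1 h with h | ⟨i, hi, e⟩
  · exact (hS.mem k).2 h
  · rw [hS.injective e] at hi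
    exact lt_irrefl _ hi

theorem mem_of_mem_stage (hS : IsReverseInclusionNumbering B₀ B₁ S) (k : Fin N)
    {T : Finset (Fin (n + 1))} (hT : T ∈ stage B₀ S k) (hTS : T ⊆ S k) : T ∈ B₀ := by
  rcases mem_stage.1 hT with h | ⟨i, hi, rfl⟩
  · exact h
  · exact absurd hi (not_lt.2 (hS.le_of_superset k i hTS))

/-- Every stage is a building set, because larger sets are added first. -/
theorem isConnectedBuildingSet_stage (hS : IsReverseInclusionNumbering B₀ B₁ S)
    (hB₀ : IsConnectedBuildingSet B₀) (hB₁ : IsBuildingSet B₁) (hsub : B₀ ⊆ B₁) (k : ℕ) :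
    IsConnectedBuildingSet (stage B₀ S k) where
  nonempty_of_mem T hT := hB₁.nonempty_of_mem T (hS.stage_subset hsub k hT)
  singleton_mem i := mem_stage.2 (Or.inl (hB₀.singleton_mem i))
  univ_mem := mem_stage.2 (Or.inl hB₀.univ_mem)
  union_mem T hT U hU h := by
    have hTU := hB₁.union_mem T (hS.stage_subset hsub k hT) U (hS.stage_subset hsub k hU) h
    rw [mem_stage]
    by_contra! hc
    obtain ⟨j, hj⟩ := (hS.mem_iff _).1 (Finset.mem_sdiff.2 ⟨hTU, hc.1⟩)
    -- A new set inside `T ∪ U` is listed no earlier than `T ∪ U`, which has not yet been added; so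
    -- `T` and `U` are both in `B₀`.
    have hold : ∀ R ∈ stage B₀ S k, R ⊆ T ∪ U → R ∈ B₀ := by
      intro R hR hRTU
      rcases mem_stage.1 hR with h | ⟨i, hi, rfl⟩
      · exact h
      · exact absurd hj (hc.2 j (lt_of_le_of_lt (hS.le_of_superset j i (hj ▸ hRTU)) hi))
    exact hc.1 (hB₀.union_mem T (hold T hT Finset.subset_union_left) U
      (hold U hU Finset.subset_union_right) h)

theorem isDisjointRep_stage (hS : IsReverseInclusionNumbering B₀ B₁ S)
    (hB₀ : IsBuildingSet B₀) (k : Fin N) :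
    IsDisjointRep (stage B₀ S k) (S k) (maximalIn B₀ (S k)) ∧
      ∀ T ∈ stage B₀ S k, T ⊆ S k → ∃ M ∈ maximalIn B₀ (S k), T ⊆ M := by
  have h := hB₀.isDisjointRep_maximalIn (S k)
  exact ⟨⟨h.subset.trans Finset.subset_union_left, h.disjoint, h.union_eq⟩,
    fun T hT hTS => exists_mem_maximalIn (hS.mem_of_mem_stage k hT hTS) hTS⟩

end IsReverseInclusionNumbering

/-- A presentation of the polytope reached after `k` steps, whose active sets are the nested sets
of the `k`-th stage and which retains the inequalities of the nestohedron of `B₀`. -/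
structure IsStagePresentation (B₀ : Finset (Finset (Fin (n + 1))))
    (S : Fin N → Finset (Fin (n + 1))) (k : ℕ) (P : Set (Fin (n + 1) → ℝ))
    (a : Finset (Fin (n + 1)) → (Fin (n + 1) → ℝ) →ₗ[ℝ] ℝ) (b : Finset (Fin (n + 1)) → ℝ) :
    Prop extends IsSimplePresentation P (stage B₀ S k) Finset.univ a b where
  mem_activeSets_iff : ∀ τ, τ ∈ activeSet (stage B₀ S k) a b '' P ↔ IsNestedSet (stage B₀ S k) τ
  functional_eq : ∀ T ∈ B₀, a T = coordSum T
  bound_eq : ∀ T ∈ B₀, b T = nestoBound B₀ T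

namespace IsStagePresentation

variable {k : Fin N} {P : Set (Fin (n + 1) → ℝ)}
  {a : Finset (Fin (n + 1)) → (Fin (n + 1) → ℝ) →ₗ[ℝ] ℝ} {b : Finset (Fin (n + 1)) → ℝ}

/-- The inequalities of `B₀` keep their functionals and bounds, so on `P` membership in a facet of
the nestohedron is tightness. For empty `D` the intersection would be the whole space. -/
theorem iInter_facets_eq (h : IsStagePresentation B₀ S k P a b)
    (hB₀ : IsConnectedBuildingSet B₀) {D : Finset (Finset (Fin (n + 1)))} (hDne : D.Nonempty)
    (hD : D ⊆ B₀) :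
    ⋂ T ∈ D, P ∩ nestoFacet B₀ T = presentedFace P (stage B₀ S k) a b D := by
  have hP : P ⊆ nestohedron B₀ := by
    intro x hx
    rw [hB₀.nestohedron_eq]
    obtain ⟨h0, h1⟩ := (h.mem_iff x).1 hx
    rw [h.functional_eq _ hB₀.univ_mem, h.bound_eq _ hB₀.univ_mem] at h0
    refine ⟨h0, fun T hT => ?_⟩
    rw [← h.functional_eq _ hT, ← h.bound_eq _ hT]
    exact h1 T (mem_stage.2 (Or.inl hT))
  have hfacet : ∀ x ∈ P, ∀ T ∈ D, (x ∈ nestoFacet B₀ T ↔ T ∈ activeSet (stage B₀ S k) a b x) := by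
    intro x hx T hT
    rw [mem_activeSet, h.functional_eq _ (hD hT), h.bound_eq _ (hD hT), coordSum_apply]
    exact ⟨fun e => ⟨mem_stage.2 (Or.inl (hD hT)), e.2⟩, fun e => ⟨hP hx, e.2⟩⟩
  ext x
  simp only [Set.mem_iInter, Set.mem_inter_iff]
  constructor
  · intro hx
    obtain ⟨T, hT⟩ := hDne
    have hxP := (hx T hT).1
    exact ⟨hxP, fun U hU => (hfacet x hxP U hU).1 (hx U hU).2⟩
  · rintro ⟨hxP, hx⟩ T hT
    exact ⟨hxP, (hfacet x hxP T hT).2 (hx hT)⟩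

theorem iInter_facets_maximalIn_eq (h : IsStagePresentation B₀ S k P a b)
    (hB₀ : IsConnectedBuildingSet B₀) (hB₁ : IsBuildingSet B₁)
    (hS : IsReverseInclusionNumbering B₀ B₁ S) :
    ⋂ T ∈ maximalIn B₀ (S k), P ∩ nestoFacet B₀ T =
      presentedFace P (stage B₀ S k) a b (maximalIn B₀ (S k)) := by
  refine h.iInter_facets_eq hB₀ ?_ (hB₀.toIsBuildingSet.isDisjointRep_maximalIn _).subset
  obtain ⟨i, hi⟩ := hB₁.nonempty_of_mem _ (hS.mem k).1
  obtain ⟨M, hM, -⟩ := exists_mem_maximalIn (hB₀.singleton_mem i) (Finset.singleton_subset_iff.2 hi)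
  exact ⟨M, hM⟩

theorem exists_isCutStep (h : IsStagePresentation B₀ S k P a b)
    (hB₀ : IsConnectedBuildingSet B₀) (hB₁ : IsBuildingSet B₁) (hsub : B₀ ⊆ B₁)
    (hS : IsReverseInclusionNumbering B₀ B₁ S) : ∃ Q, IsCutStep B₀ (S k) P Q := by
  have hB := hS.isConnectedBuildingSet_stage hB₀ hB₁ hsub k
  obtain ⟨hD, hmax⟩ := hS.isDisjointRep_stage hB₀.toIsBuildingSet k
  have hnest := hD.isNestedSet_insert_univ hB hmax
  obtain ⟨x, hx, ex⟩ := (h.mem_activeSets_iff _).2 hnest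
  -- A point where only the root is active. If it lay on the face, a block of `S k` would be the
  -- whole ground set, so `S k` would be in `B₀`; hence the face is proper.
  obtain ⟨y, hy, ey⟩ := (h.mem_activeSets_iff {Finset.univ}).2
    (hnest.mono (by simp) (Finset.mem_singleton_self _))
  obtain ⟨Q, hQ⟩ := h.exists_isShaving (D := maximalIn B₀ (S k))
    ⟨x, hx, by rw [ex]; exact Finset.subset_insert _ _⟩ (fun e => by
      obtain ⟨i, hi⟩ := hB₁.nonempty_of_mem _ (hS.mem k).1
      obtain ⟨M, hM, -⟩ := exists_mem_maximalIn (hB₀.singleton_mem i)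
        (Finset.singleton_subset_iff.2 hi)
      rw [← e] at hy
      have hMu := hy.2 hM
      rw [ey, Finset.mem_singleton] at hMu
      have hSu := Finset.univ_subset_iff.1 (hMu ▸ hD.subset_of_mem hM)
      exact (hS.mem k).2 (hSu ▸ hB₀.univ_mem))
  refine ⟨Q, _, hB₀.toIsBuildingSet.isDecomposition_maximalIn (S k), ?_⟩
  rwa [h.iInter_facets_maximalIn_eq hB₀ hB₁ hS]

/-- Geometry meets combinatorics: `mem_activeSets_shave_iff` and `isNestedSet_insert_iff` describe
the same subdivision. -/
theorem exists_succ (h : IsStagePresentation B₀ S k P a b)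
    (hB₀ : IsConnectedBuildingSet B₀) (hB₁ : IsBuildingSet B₁) (hsub : B₀ ⊆ B₁)
    (hS : IsReverseInclusionNumbering B₀ B₁ S) {Q : Set (Fin (n + 1) → ℝ)}
    (hQ : IsCutStep B₀ (S k) P Q) : ∃ a' b', IsStagePresentation B₀ S (k + 1) Q a' b' := by
  have hB := hS.isConnectedBuildingSet_stage hB₀ hB₁ hsub k
  have hB' := hS.isConnectedBuildingSet_stage hB₀ hB₁ hsub (k + 1)
  rw [stage_succ] at hB'
  obtain ⟨hD, hmax⟩ := hS.isDisjointRep_stage hB₀.toIsBuildingSet k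
  have hk := hS.notMem_stage k
  obtain ⟨D, hdec, -, -, -, l, c, ε, -, hface, hε, hlt, rfl⟩ := hQ
  obtain rfl := hB₀.toIsBuildingSet.eq_maximalIn_of_isDecomposition hdec
  rw [h.iInter_facets_maximalIn_eq hB₀ hB₁ hS] at hface hlt
  have hne : ∀ T ∈ B₀, T ≠ S k := fun T hT e => (hS.mem k).2 (e ▸ hT)
  refine ⟨Function.update a (S k) (-l), Function.update b (S k) (-(c - ε)), ?_, fun τ => ?_,
    fun T hT => ?_, fun T hT => ?_⟩
  · rw [stage_succ]
    exact h.shave hk hface hε hlt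
  · rw [stage_succ, h.mem_activeSets_shave_iff hk hface hε hlt,
      hB.toIsBuildingSet.isNestedSet_insert_iff hB.univ_mem hk hB'.toIsBuildingSet hD hmax]
    simp only [h.mem_activeSets_iff]
  · rw [Function.update_of_ne (hne T hT), h.functional_eq T hT]
  · rw [Function.update_of_ne (hne T hT), h.bound_eq T hT]

end IsStagePresentation

theorem IsCutSequence.exists_isStagePresentation (hB₀ : IsConnectedBuildingSet B₀)
    (hB₁ : IsBuildingSet B₁) (hsub : B₀ ⊆ B₁) (hS : IsReverseInclusionNumbering B₀ B₁ S)
    {P : ℕ → Set (Fin (n + 1) → ℝ)} (k : ℕ) (hk : k ≤ N) (hP : IsCutSequence B₀ S k P) :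
    ∃ a b, IsStagePresentation B₀ S k (P k) a b := by
  induction k with
  | zero =>
    have h0 : stage B₀ S 0 = B₀ := by ext T; simp [mem_stage]
    refine ⟨coordSum, nestoBound B₀, ?_, ?_, fun _ _ => rfl, fun _ _ => rfl⟩
    · rw [h0, hP.1]; exact hB₀.isSimplePresentation
    · rw [h0, hP.1]; exact hB₀.mem_activeSets_iff
  | succ k ih =>
    obtain ⟨a, b, h⟩ := ih (by omega) ⟨hP.1, fun i hi => hP.2 i (by omega)⟩
    let j : Fin N := ⟨k, hk⟩
    have h' : IsStagePresentation B₀ S j (P j) a b := h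
    exact h'.exists_succ hB₀ hB₁ hsub hS (hP.2 j (Nat.lt_succ_self k))

end CuttingProcedure

/-- The cutting procedure never gets stuck, whatever choices have been made so far, and every
polytope `P_cut = P N` that it produces is combinatorially equivalent to `P_{B₁}`. -/
theorem mainTheorem5 (n : ℕ) (B₀ B₁ : Finset (Finset (Fin (n + 1))))
    (hB₀ : IsConnectedBuildingSet B₀) (hB₁ : IsConnectedBuildingSet B₁) (hsub : B₀ ⊆ B₁)
    (N : ℕ) (S : Fin N → Finset (Fin (n + 1)))
    (hS : IsReverseInclusionNumbering B₀ B₁ S) :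
    (∀ (k : Fin N) (P : ℕ → Set (Fin (n + 1) → ℝ)), IsCutSequence B₀ S k P →
      ∃ Q, IsCutStep B₀ (S k) (P k) Q) ∧
    (∀ P : ℕ → Set (Fin (n + 1) → ℝ), IsCutSequence B₀ S N P →
      CombEquiv (P N) (nestohedron B₁)) := by
  refine ⟨fun k P hP => ?_, fun P hP => ?_⟩
  · obtain ⟨a, b, h⟩ :=
      hP.exists_isStagePresentation hB₀ hB₁.toIsBuildingSet hsub hS k k.2.le
    exact h.exists_isCutStep hB₀ hB₁.toIsBuildingSet hsub hS
  · obtain ⟨a, b, h⟩ := hP.exists_isStagePresentation hB₀ hB₁.toIsBuildingSet hsub hS N le_rfl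
    refine h.combEquiv hB₁.isSimplePresentation (Set.ext fun τ => ?_)
    rw [h.mem_activeSets_iff, hB₁.mem_activeSets_iff, hS.stage_eq hsub]
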